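/- Let $[\overline n]:=\{1<2<\dots<n<\overline n<\dots<\overline 2<\overline 1\}$, with the involution $i\mapsto\overline{\imath}$, $\overline{\overline{\imath}}=i$, and $|i|=|\overline{\imath}|=i$ for $i\in[n]$. Let $B_n$ be the group of signed permutations, i.e. bijections $w$ of $[\overline n]$ with $w(\overline{\imath})=\overline{w(i)}$, with length $\ell(w)=\#\{(k,l)\in[n]\times[\overline n]: k\le |l|,\ w(k)>w(l)\}$. The positive roots of type $C_n$ are $\varepsilon_i-\varepsilon_j$, denoted $(i,j)$, and $\varepsilon_i+\varepsilon_j$, denoted $(i,\overline{\jmath})$, for $1\le i<j\le n$, and $2\varepsilon_i$, denoted $(i,\overline{\imath})$, for $1\le i\le n$; the corresponding reflections $s_\alpha\in B_n$ are $t_{ij}t_{\overline{\jmath}\,\overline{\imath}}$, $t_{i\overline{\jmath}}t_{j\overline{\imath}}$ and $t_{i\overline{\imath}}$, where $t_{ab}$ is the transposition of $a,b\in[\overline n]$. Let $\rho=(n,n-1,\dots,1)$ and $\alpha^\vee=2\alpha/\langle\alpha,\alpha\rangle$. The quantum Bruhat graph on $B_n$ has an edge $w\to ws_\alpha$ labelled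 by the positive root $\alpha$ if $\ell(ws_\alpha)=\ell(w)+1$ or $\ell(ws_\alpha)=\ell(w)-2\langle\rho,\alpha^\vee\rangle+1$. For $k\le n$ let $\Gamma_r(k)$ be the concatenation $\Gamma_2\cdots\Gamma_k$, where $\Gamma_i=((1,\overline{\imath}),(2,\overline{\imath}),\dots,(i-1,\overline{\imath}))$, and let $\mathrm{rev}$ denote reversal of a sequence. A column of height $k$ is a sequence $C=(C(1),\dots,C(k))$ in $[\overline n]$ whose entries have pairwise distinct absolute values; $\mathrm{ord}(C)$ is $C$ sorted increasingly; and $w[1,k]:=(w(1),\dots,w(k))$. For two columns $C',C$ of height $k$, the pair $C'C$ satisfies Condition 1$'$ if for no $1\le i<l\le k$ one has $C(i)=C'(l)$ or $C(i)\prec C'(l)\prec C'(i)$, where $a\prec b\prec c$ means that $a,b,c$ are distinct and are met in this order when going around the circle $1,2,\dots,n,\overline n,\dots,\overline 1$ from $a$. A KN (Kashiwara-Nakashima) column of height $k$ is a strictly increasing sequence $D$ of $k$ elements of $[\overline n]$ (which may contain both $z$ and $\overline z$) with the following property. Let $z_1>\dots>z_r$ be all the $z\in[n]$ with $z,\overline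 z\in D$; then there are $t_1>\dots>t_r$ in $[n]$ such that $t_1$ is the greatest $t\in[n]$ with $t<z_1$ and $t,\overline t\notin D$, and, for $i\ge 2$, $t_i$ is the greatest $t\in[n]$ with $t<\min(t_{i-1},z_i)$ and $t,\overline t\notin D$. Then $rD$ (respectively $lD$) is obtained from $D$ by replacing each $\overline{z_i}$ by $\overline{t_i}$ (respectively each $z_i$ by $t_i$) and sorting increasingly. **Proposition.** Let $k\le n$, let $u\in B_n$, let $C:=u[1,k]$, and let $C'$ be a column of height $k$. Then the pair $C'C$ satisfies Condition 1$'$ and $(\mathrm{ord}(C'),\mathrm{ord}(C))=(rD,lD)$ for some KN column $D$ if and only if there is a path $u=u_0,u_1,\dots,u_p=v$ in the quantum Bruhat graph such that $v[1,k]=C'$ and the sequence of edge labels is a subsequence of $\mathrm{rev}(\Gamma_r(k))$. Moreover, such a path is unique if it exists, and along it, for each $i=1,\dots,k$, one has $C(i)=u_0(i)\le u_1(i)\le\dots\le u_p(i)=C'(i)$, with all these entries in $[n]$ or all of them in $[\overline n]\setminus[n]$. -/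

import Mathlib

namespace TypeC

/-- The ordered alphabet `1 < 2 < ⋯ < n < n̄ < ⋯ < 2̄ < 1̄`, realised as `Fin (2 * n)`: the letter
`i` is the element of value `i - 1`, and `ī` is the element of value `2n - i`. The linear order is
that of `Fin (2 * n)`, and the circular order is the one Mathlib puts on `Fin (2 * n)`. -/
abbrev Letter (n : ℕ) : Type := Fin (2 * n)

/-- The order-reversing involution `i ↦ ī`. -/
def bar {n : ℕ} (x : Letter n) : Letter n := Fin.rev x

/-- The inclusion of `[n]` in the alphabet. -/
def pos {n : ℕ} (i : Fin n) : Letter n := ⟨i.1, by omega⟩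

/-- `x` is unbarred, that is, `x ∈ [n]`. -/
def IsUnbarred {n : ℕ} (x : Letter n) : Prop := x.1 < n

/-- The absolute value `|i| = |ī| = i`. -/
def absLetter {n : ℕ} (x : Letter n) : Letter n := min x (bar x)

theorem bar_bar {n : ℕ} (x : Letter n) : bar (bar x) = x := Fin.rev_rev x

theorem bar_injective {n : ℕ} : Function.Injective (bar : Letter n → Letter n) :=
  Fin.rev_injective

/-- The group `B_n` of signed permutations: the permutations `w` of the alphabet such that
`w(ī)` is the bar of `w(i)`. -/
def SignedPerm (n : ℕ) : Subgroup (Equiv.Perm (Letter n)) where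
  carrier := {w | ∀ x, w (bar x) = bar (w x)}
  mul_mem' := by
    intro a b ha hb x
    simp only [Equiv.Perm.mul_apply]
    rw [hb, ha]
  one_mem' := by intro x; rfl
  inv_mem' := by
    intro a ha x
    rw [Equiv.Perm.inv_eq_iff_eq, ha]
    simp

/-- The length of a signed permutation, as a number of inversions:
`ℓ(w) = #{(k, l) ∈ [n] × [n̄] : k ≤ |l|, w(k) > w(l)}`. -/
def length {n : ℕ} (w : SignedPerm n) : ℕ :=
  (Finset.univ.filter fun p : Fin n × Letter n =>
    pos p.1 ≤ absLetter p.2 ∧ w.1 p.2 < w.1 (pos p.1)).card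

/-- The positive roots of type `C_n`. -/
inductive PosRoot (n : ℕ) : Type
  /-- `(i, j)`, the root `ε_i - ε_j`. -/
  | minus (i j : Fin n) (h : i < j) : PosRoot n
  /-- `(i, j̄)`, the root `ε_i + ε_j`. -/
  | plus (i j : Fin n) (h : i < j) : PosRoot n
  /-- `(i, ī)`, the root `2 ε_i`. -/
  | long (i : Fin n) : PosRoot n

/-- The coroot `α^∨ = 2 α / ⟨α, α⟩`, in the coordinates `ε_1, …, ε_n`. -/
def PosRoot.coroot {n : ℕ} : PosRoot n → Fin n → ℤ
  | .minus i j _ => Pi.single i 1 - Pi.single j 1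
  | .plus i j _ => Pi.single i 1 + Pi.single j 1
  | .long i => Pi.single i 1

/-- `ρ = (n, n - 1, …, 1)`, half the sum of the positive roots. -/
def rho (n : ℕ) : Fin n → ℤ := fun i => (n : ℤ) - (i.1 : ℤ)

/-- The reflection of a positive root, as a permutation of the alphabet. -/
def PosRoot.reflPerm {n : ℕ} : PosRoot n → Equiv.Perm (Letter n)
  | .minus i j _ => Equiv.swap (pos i) (pos j) * Equiv.swap (bar (pos j)) (bar (pos i))
  | .plus i j _ => Equiv.swap (pos i) (bar (pos j)) * Equiv.swap (pos j) (bar (pos i))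
  | .long i => Equiv.swap (pos i) (bar (pos i))

theorem PosRoot.reflPerm_mem {n : ℕ} (α : PosRoot n) : α.reflPerm ∈ SignedPerm n := by
  intro x
  cases α with
  | minus i j h =>
    simp only [reflPerm, Equiv.Perm.mul_apply, Equiv.swap_apply_def, pos, bar, Fin.ext_iff] at *
    split_ifs <;> simp only [Fin.val_rev] at * <;> omega
  | plus i j h =>
    simp only [reflPerm, Equiv.Perm.mul_apply, Equiv.swap_apply_def, pos, bar, Fin.ext_iff] at *
    split_ifs <;> simp only [Fin.val_rev] at * <;> omega
  | long i =>
    simp only [reflPerm, Equiv.swap_apply_def, pos, bar, Fin.ext_iff] at *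
    split_ifs <;> simp only [Fin.val_rev] at * <;> omega

/-- The reflection `s_α` in the Weyl group `B_n`. -/
def PosRoot.refl {n : ℕ} (α : PosRoot n) : SignedPerm n := ⟨α.reflPerm, α.reflPerm_mem⟩

/-- The edge `w ⟶ w'` labelled by `α` of the quantum Bruhat graph: `w' = w s_α`, and either
`ℓ(w s_α) = ℓ(w) + 1` (a Bruhat edge) or `ℓ(w s_α) = ℓ(w) - 2⟨ρ, α^∨⟩ + 1` (a quantum edge). -/
def QBEdge {n : ℕ} (w : SignedPerm n) (α : PosRoot n) (w' : SignedPerm n) : Prop :=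
  w' = w * α.refl ∧
    ((length w' : ℤ) = length w + 1 ∨
      (length w' : ℤ) = length w - 2 * (rho n ⬝ᵥ α.coroot) + 1)

/-- A list `[(α₁, u₁), …, (α_p, u_p)]` is a path in the quantum Bruhat graph from `u = u₀` if
`u_{j-1} ⟶ u_j` is an edge labelled by `α_j` for all `j`. -/
def IsQBPath {n : ℕ} : SignedPerm n → List (PosRoot n × SignedPerm n) → Prop
  | _, [] => True
  | u, (α, w) :: P => QBEdge u α w ∧ IsQBPath w P

/-- The sequence of edge labels of a path. -/
def labels {n : ℕ} (P : List (PosRoot n × SignedPerm n)) : List (PosRoot n) := P.map Prod.fst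

/-- The sequence of vertices `u₀ = u, u₁, …, u_p` of a path from `u`. -/
def vertices {n : ℕ} (u : SignedPerm n) (P : List (PosRoot n × SignedPerm n)) :
    List (SignedPerm n) := u :: P.map Prod.snd

/-- The last vertex `u_p` of a path from `u`. -/
def endpoint {n : ℕ} (u : SignedPerm n) (P : List (PosRoot n × SignedPerm n)) : SignedPerm n :=
  (vertices u P).getLast (List.cons_ne_nil _ _)

/-- `Γ_r(k) = Γ_2 ⋯ Γ_k`, where `Γ_i = ((1, ī), (2, ī), …, (i - 1, ī))`. (The segment for `i = 1`
is empty.) -/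
def GammaR {n : ℕ} (k : ℕ) (hk : k ≤ n) : List (PosRoot n) :=
  (List.finRange k).flatMap fun i =>
    (List.finRange i.1).map fun j =>
      PosRoot.plus ⟨j.1, by omega⟩ ⟨i.1, by omega⟩ (by simp [Fin.lt_def])

/-- The column `w[1, k] = w(1) ⋯ w(k)`. -/
def window {n k : ℕ} (hk : k ≤ n) (w : SignedPerm n) : Fin k → Letter n :=
  fun i => w.1 (pos (Fin.castLE hk i))

/-- A column of height `k` (a column of a filling): entries with pairwise distinct absolute
values, in any order. -/
def IsColumn {n k : ℕ} (C : Fin k → Letter n) : Prop :=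
  Function.Injective fun i => absLetter (C i)

/-- The pair `C'C`: for no `i < l` is `C(i) = C'(l)` or `C(i) ≺ C'(l) ≺ C'(i)`. The latter is
strict betweenness in the circular order of the alphabet. -/
def ConditionOne {n k : ℕ} (C' C : Fin k → Letter n) : Prop :=
  ∀ i l : Fin k, i < l → C i ≠ C' l ∧ ¬ sbtw (C i) (C' l) (C' i)

/-- Sorting a column in increasing order. -/
def ord {n k : ℕ} (C : Fin k → Letter n) : Fin k → Letter n := C ∘ Tuple.sort C

open Classical in
/-- The set `I` of unbarred letters `z` such that both `z` and `z̄` occur in `D`. -/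
noncomputable def pairSet {n k : ℕ} (D : Fin k → Letter n) : Finset (Letter n) :=
  Finset.univ.filter fun z => IsUnbarred z ∧ z ∈ Set.range D ∧ bar z ∈ Set.range D

/-- The decreasing enumeration `z₁ > ⋯ > z_r` of `I`. -/
noncomputable def pairSeq {n k : ℕ} (D : Fin k → Letter n) :
    Fin (pairSet D).card → Letter n :=
  fun i => (pairSet D).orderEmbOfFin rfl (Fin.rev i)

/-- The sequence `t₁, …, t_r` splits `D`: each `t_i` is the greatest letter `t ∈ [n]` with
`t < z_i`, `t < t_{i-1}` (if `i > 1`), `t ∉ D` and `t̄ ∉ D`. -/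
def IsSplitting {n k : ℕ} (D : Fin k → Letter n) (t : Fin (pairSet D).card → Letter n) : Prop :=
  ∀ i, IsGreatest {x : Letter n | IsUnbarred x ∧ x < pairSeq D i ∧
    (∀ j, j.1 + 1 = i.1 → x < t j) ∧ x ∉ Set.range D ∧ bar x ∉ Set.range D} (t i)

/-- A Kashiwara–Nakashima column of height `k`: a strictly increasing filling that can be split.
The splitting sequence is determined by the entries. -/
structure KNColumn (n k : ℕ) where
  entries : Fin k → Letter n
  strictMono : StrictMono entries
  t : Fin (pairSet entries).card → Letter n
  isSplitting : IsSplitting entries t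

/-- `rD`: change each `z̄_i` into `t̄_i` in `D`, and reorder. -/
noncomputable def KNColumn.right {n k : ℕ} (D : KNColumn n k) : Fin k → Letter n :=
  ord (Function.extend (bar ∘ pairSeq D.entries) (bar ∘ D.t) id ∘ D.entries)

/-- `lD`: change each `z_i` into `t_i` in `D`, and reorder. -/
noncomputable def KNColumn.left {n k : ℕ} (D : KNColumn n k) : Fin k → Letter n :=
  ord (Function.extend (pairSeq D.entries) D.t id ∘ D.entries)

/-- `P` is a path `u = u₀, u₁, …, u_p = v` in the quantum Bruhat graph such that `v[1, k] = C'` and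
the edge labels form a subsequence of the reverse of `Γ_r(k)`. -/
def IsRightPath {n k : ℕ} (hk : k ≤ n) (u : SignedPerm n) (C' : Fin k → Letter n)
    (P : List (PosRoot n × SignedPerm n)) : Prop :=
  IsQBPath u P ∧ window hk (endpoint u P) = C' ∧ (labels P).Sublist (GammaR k hk).reverse

end TypeC

/-!
A step labelled `ε_i + ε_j` replaces the values `a` and `b̄` at the positions `i < j` by `b` and
`ā`. It is never a quantum edge, since the length cannot drop that far, and it is a covering edge
exactly when `a < b` lie in the same half of the alphabet and no value at a position after `i`,
nor the bar of one at a position after `j`, lies strictly between them. Hence in the reverse of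
`Γ_i` the value at `i` moves up through bars of values at earlier positions, and the step at a
given position is taken if and only if the bar of the value there lies above the current value at
`i` and not above the final one. So the final value at `i` determines the part of the path inside
`Γ_i`, and by induction on `k` the final window determines the path.

Conversely, taking greedily every step that does not overshoot the prescribed value reaches `C'`
from `C`, provided that the entries move up inside their halves, that the absolute values are the
same, that no entry moves past a letter whose absolute value does not occur, and that no later
entry of `C'` lies in `[C(i), C'(i))`. The last requirement is Condition 1'. The others amount,
once `C(i) ≤ C'(i)` for all `i`, to comparing for each `y` the numbers of entries `≥ y` of `C` and
`C'`, hence depend only on `ord(C)` and `ord(C')`. They say that these are `lD` and `rD`, where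
`D` consists of the unbarred entries of `C'` and the barred entries of `C`.
-/

namespace TypeC

open Set

section Letters

variable {n : ℕ}

@[grind =]
theorem val_bar (x : Letter n) : (bar x).1 = 2 * n - 1 - x.1 := by
  simp only [bar, Fin.val_rev]
  omega

@[grind =]
theorem isUnbarred_iff (x : Letter n) : IsUnbarred x ↔ x.1 < n := Iff.rfl

instance : DecidablePred (IsUnbarred (n := n)) := fun x => inferInstanceAs (Decidable (x.1 < n))

theorem isUnbarred_bar {x : Letter n} : IsUnbarred (bar x) ↔ ¬IsUnbarred x := by grind

theorem bar_ne_self (x : Letter n) : bar x ≠ x := fun h => by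
  have hx := isUnbarred_bar (x := x)
  rw [h] at hx
  exact iff_not_self hx

theorem pos_injective : Function.Injective (pos : Fin n → Letter n) :=
  fun i j h => by simpa [pos, Fin.ext_iff] using h

theorem isUnbarred_pos (i : Fin n) : IsUnbarred (pos i) := i.2

theorem pos_ne_bar_pos (i j : Fin n) : pos i ≠ bar (pos j) := fun h =>
  isUnbarred_bar.1 (h ▸ isUnbarred_pos i) (isUnbarred_pos j)

theorem exists_eq_pos_or_eq_bar_pos (x : Letter n) : ∃ i : Fin n, x = pos i ∨ x = bar (pos i) := by
  by_cases hx : IsUnbarred x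
  · exact ⟨⟨x.1, hx⟩, Or.inl rfl⟩
  · exact ⟨⟨(bar x).1, isUnbarred_bar.2 hx⟩, Or.inr (bar_bar x).symm⟩

theorem absLetter_pos (i : Fin n) : absLetter (pos i) = pos i := by
  have := isUnbarred_pos i
  grind [absLetter]

theorem absLetter_bar (x : Letter n) : absLetter (bar x) = absLetter x := by
  rw [absLetter, absLetter, bar_bar, min_comm]

theorem absLetter_eq_iff {x y : Letter n} : absLetter x = absLetter y ↔ x = y ∨ x = bar y := by
  grind [absLetter]

theorem sum_letter {M : Type*} [AddCommMonoid M] (f : Letter n → M) :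
    ∑ x, f x = ∑ i : Fin n, (f (pos i) + f (bar (pos i))) := by
  let e : Fin n ⊕ Fin n → Letter n := Sum.elim pos (bar ∘ pos)
  have he : Function.Bijective e := by
    refine ⟨?_, fun x => ?_⟩
    · exact pos_injective.sumElim (bar_injective.comp pos_injective) pos_ne_bar_pos
    · obtain ⟨i, hi | hi⟩ := exists_eq_pos_or_eq_bar_pos x
      exacts [⟨.inl i, hi.symm⟩, ⟨.inr i, hi.symm⟩]
  rw [← he.sum_comp, Fintype.sum_sum_type, Finset.sum_add_distrib]
  rfl

end Letters

section Values

variable {n : ℕ} (w : SignedPerm n)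

/-- The value `w(i)` of a signed permutation at a position `i ∈ [n]`. -/
def value (i : Fin n) : Letter n := w.1 (pos i)

theorem apply_bar (x : Letter n) : w.1 (bar x) = bar (w.1 x) := w.2 x

theorem value_injective : Function.Injective (value w) := w.1.injective.comp pos_injective

theorem value_ne_bar_value (i j : Fin n) : value w i ≠ bar (value w j) := by
  rw [value, value, ← apply_bar]
  exact w.1.injective.ne (pos_ne_bar_pos i j)

theorem exists_value_eq_or_eq_bar (y : Letter n) : ∃ i, value w i = y ∨ value w i = bar y := by
  obtain ⟨i, hi | hi⟩ := exists_eq_pos_or_eq_bar_pos (w.1.symm y)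
  · exact ⟨i, Or.inl (by rw [value, ← hi, Equiv.apply_symm_apply])⟩
  · refine ⟨i, Or.inr ?_⟩
    rw [value, ← bar_bar (pos i), ← hi, apply_bar, Equiv.apply_symm_apply]

variable {w} in
theorem eq_of_value_eq {w' : SignedPerm n} (h : ∀ i, value w i = value w' i) : w = w' := by
  refine Subtype.ext (Equiv.ext fun x => ?_)
  obtain ⟨i, rfl | rfl⟩ := exists_eq_pos_or_eq_bar_pos x
  · exact h i
  · rw [apply_bar, apply_bar]
    exact congrArg bar (h i)

section Reflection

variable {i j : Fin n} (h : i < j)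

theorem value_mul_refl_left : value (w * (PosRoot.plus i j h).refl) i = bar (value w j) := by
  have hij : pos i ≠ pos j := pos_injective.ne h.ne
  rw [value, value, ← apply_bar]
  refine congrArg w.1 ?_
  simp only [PosRoot.refl, PosRoot.reflPerm, Equiv.Perm.mul_apply]
  rw [Equiv.swap_apply_of_ne_of_ne hij (pos_ne_bar_pos i i), Equiv.swap_apply_left]

theorem value_mul_refl_right : value (w * (PosRoot.plus i j h).refl) j = bar (value w i) := by
  have hij : bar (pos i) ≠ bar (pos j) := (bar_injective.comp pos_injective).ne h.ne
  rw [value, value, ← apply_bar]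
  refine congrArg w.1 ?_
  simp only [PosRoot.refl, PosRoot.reflPerm, Equiv.Perm.mul_apply, Equiv.swap_apply_left]
  rw [Equiv.swap_apply_of_ne_of_ne (pos_ne_bar_pos i i).symm hij]

theorem value_mul_refl_of_ne {m : Fin n} (hi : m ≠ i) (hj : m ≠ j) :
    value (w * (PosRoot.plus i j h).refl) m = value w m := by
  refine congrArg w.1 ?_
  simp only [PosRoot.refl, PosRoot.reflPerm, Equiv.Perm.mul_apply]
  rw [Equiv.swap_apply_of_ne_of_ne (pos_injective.ne hj) (pos_ne_bar_pos m i),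
    Equiv.swap_apply_of_ne_of_ne (pos_injective.ne hi) (pos_ne_bar_pos m j)]

end Reflection

end Values

section Length

variable {n : ℕ}

/-- The number of inversions contributed by the values `x`, `y` at two positions `k ≤ l`: the
position `l` stands for both `l` and `l̄`. -/
def invPair (x y : Letter n) : ℤ := (if y < x then 1 else 0) + (if bar y < x then 1 else 0)

theorem length_eq_sum (w : SignedPerm n) :
    (length w : ℤ) =
      ∑ k : Fin n, ∑ l : Fin n, if k ≤ l then invPair (value w k) (value w l) else 0 := by
  have hcast : (length w : ℤ) = ∑ p : Fin n × Letter n,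
      if pos p.1 ≤ absLetter p.2 ∧ w.1 p.2 < w.1 (pos p.1) then (1 : ℤ) else 0 := by
    rw [length, Finset.card_filter]
    push_cast
    rfl
  rw [hcast, Fintype.sum_prod_type]
  refine Finset.sum_congr rfl fun k _ => ?_
  rw [sum_letter]
  refine Finset.sum_congr rfl fun l _ => ?_
  have hkl : pos k ≤ pos l ↔ k ≤ l := Iff.rfl
  simp only [absLetter_bar, absLetter_pos, hkl, apply_bar, invPair, value]
  by_cases h : k ≤ l
  · simp only [h, true_and, if_true]
    congr
  · simp [h]

/-- The number of times, counted with sign, that a value moving from `a` to `b` passes the letter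
`c`. For `a < b` it is the indicator of `a ≤ c < b`. -/
def crossing (a b c : Letter n) : ℤ := (if c < b then 1 else 0) - (if c < a then 1 else 0)

/-- Half the contribution of the position `m` to the change of length when the values `a`, `b̄` at
the positions `i < j` are changed into `b`, `ā`, where `c` is the value at `m`. -/
def lengthChange (i j m : Fin n) (a b c : Letter n) : ℤ :=
  (if i < m then crossing a b c else 0) + (if j < m then crossing a b (bar c) else 0)

theorem sum_sum_eq_add_sum_erase {ι M : Type*} [Fintype ι] [DecidableEq ι]
    [AddCommMonoid M] {i j : ι} (hij : i ≠ j) (d : ι → ι → M)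
    (hd : ∀ k l, k ≠ i → k ≠ j → l ≠ i → l ≠ j → d k l = 0) :
    ∑ k, ∑ l, d k l = (d i i + d i j + d j i + d j j) +
      ∑ m ∈ (Finset.univ.erase i).erase j, (d m i + d m j + d i m + d j m) := by
  have split_off (f : ι → M) : ∑ m, f m = f i + f j + ∑ m ∈ (Finset.univ.erase i).erase j, f m := by
    rw [← Finset.add_sum_erase _ f (Finset.mem_univ i),
      ← Finset.add_sum_erase _ f (Finset.mem_erase.2 ⟨hij.symm, Finset.mem_univ j⟩), add_assoc]
  have hrest : ∑ k ∈ (Finset.univ.erase i).erase j, ∑ l, d k l =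
      ∑ k ∈ (Finset.univ.erase i).erase j, (d k i + d k j) := by
    refine Finset.sum_congr rfl fun k hk => ?_
    simp only [Finset.mem_erase, Finset.mem_univ, and_true] at hk
    rw [split_off, Finset.sum_eq_zero, add_zero]
    intro l hl
    simp only [Finset.mem_erase, Finset.mem_univ, and_true] at hl
    exact hd k l hk.2 hk.1 hl.2 hl.1
  rw [split_off (fun k => ∑ l, d k l), split_off (d i), split_off (d j), hrest]
  simp only [Finset.sum_add_distrib]
  abel

theorem invPair_change_self {a b : Letter n} (hab : a ≠ b) :
    (invPair b b - invPair a a) + (invPair b (bar a) - invPair a (bar b)) +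
      (invPair (bar a) (bar a) - invPair (bar b) (bar b)) = (if a < b then 1 else -1) +
        2 * ((if IsUnbarred a then 1 else 0) - (if IsUnbarred b then 1 else 0)) := by
  have := bar_ne_self a
  have := bar_ne_self b
  grind [invPair]

theorem invPair_change_between {a b c : Letter n} (ha : c ≠ a) (hb : c ≠ b) (ha' : c ≠ bar a)
    (hb' : c ≠ bar b) :
    (invPair b c - invPair a c) + (invPair c (bar a) - invPair c (bar b)) = 2 * crossing a b c := by
  grind [invPair, crossing]

theorem invPair_change_right {a b c : Letter n} (ha : c ≠ a) (hb : c ≠ b) (ha' : c ≠ bar a)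
    (hb' : c ≠ bar b) :
    (invPair b c - invPair a c) + (invPair (bar a) c - invPair (bar b) c) =
      2 * (crossing a b c + crossing a b (bar c)) := by
  grind [invPair, crossing]

theorem length_mul_refl (w : SignedPerm n) {i j : Fin n} (h : i < j) :
    (length (w * (PosRoot.plus i j h).refl) : ℤ) = length w +
      ((if value w i < bar (value w j) then 1 else -1) +
        2 * ((if IsUnbarred (value w i) then 1 else 0) -
          (if IsUnbarred (bar (value w j)) then 1 else 0)) +
        2 * ∑ m ∈ (Finset.univ.erase i).erase j,
          lengthChange i j m (value w i) (bar (value w j)) (value w m)) := by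
  rw [← sub_eq_iff_eq_add', length_eq_sum, length_eq_sum, ← Finset.sum_sub_distrib]
  simp only [← Finset.sum_sub_distrib]
  have hi := value_mul_refl_left w h
  have hj := value_mul_refl_right w h
  have hm {m} := value_mul_refl_of_ne w h (m := m)
  rw [sum_sum_eq_add_sum_erase h.ne _ fun k l hki hkj hli hlj => by
    rw [hm hki hkj, hm hli hlj, sub_self], Finset.mul_sum]
  congr 1
  · rw [← invPair_change_self (value_ne_bar_value w i j), hi, hj, bar_bar]
    simp only [le_refl, if_true, h.le, h.not_ge, if_false]
    ring
  · refine Finset.sum_congr rfl fun m hmem => ?_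
    obtain ⟨hmj, hmi⟩ : m ≠ j ∧ m ≠ i := by simpa using hmem
    have ha : value w m ≠ value w i := (value_injective w).ne hmi
    have hb : value w m ≠ bar (bar (value w j)) := by rwa [bar_bar, (value_injective w).ne_iff]
    have ha' := value_ne_bar_value w m i
    have hb' := value_ne_bar_value w m j
    have hbetween := invPair_change_between ha hb' ha' hb
    have hright := invPair_change_right ha hb' ha' hb
    rw [hi, hj, hm hmi hmj]
    rw [bar_bar] at hbetween hright
    rcases lt_or_gt_of_ne hmi with hmi | him
    · simp only [lengthChange, invPair]
      grind
    · simp only [lengthChange]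
      grind

end Length

section Edges

variable {n : ℕ}

/-- The combinatorial form of an edge `w ⟶ w'` labelled by the root `ε_i + ε_j`. -/
structure Step (w : SignedPerm n) (i j : Fin n) (w' : SignedPerm n) : Prop where
  lt : i < j
  left : value w' i = bar (value w j)
  right : value w' j = bar (value w i)
  of_ne : ∀ m, m ≠ i → m ≠ j → value w' m = value w m
  value_lt : value w i < value w' i
  side : IsUnbarred (value w i) ↔ IsUnbarred (value w' i)
  between : ∀ m, i < m → m < j → value w m ∉ Ioo (value w i) (value w' i)
  beyond : ∀ m, j < m →
    value w m ∉ Ioo (value w i) (value w' i) ∧ value w m ∉ Ioo (value w j) (value w' j)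

variable {a b : Letter n}

theorem lengthChange_nonneg (i j m : Fin n) (h : a ≤ b) (c : Letter n) :
    0 ≤ lengthChange i j m a b c := by
  grind [lengthChange, crossing]

theorem lengthChange_nonpos (i j m : Fin n) (h : b ≤ a) (c : Letter n) :
    lengthChange i j m a b c ≤ 0 := by
  grind [lengthChange, crossing]

theorem neg_le_lengthChange (i j m : Fin n) (a b c : Letter n) :
    -((if i < m then 1 else 0) + (if j < m then 1 else 0)) ≤ lengthChange i j m a b c := by
  grind [lengthChange, crossing]

theorem lengthChange_eq_zero_iff {i j m : Fin n} {c : Letter n} (h : a < b) :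
    lengthChange i j m a b c = 0 ↔
      (i < m → c ∉ Ico a b) ∧ (j < m → bar c ∉ Ico a b) := by
  grind [lengthChange, crossing]

theorem rho_dotProduct_coroot_plus {i j : Fin n} (h : i < j) :
    rho n ⬝ᵥ (PosRoot.plus i j h).coroot = 2 * n - i.1 - j.1 := by
  simp only [PosRoot.coroot, dotProduct_add, dotProduct_single_one, rho]
  ring

theorem sum_ite_lt (i : Fin n) : ∑ m : Fin n, (if i < m then (1 : ℤ) else 0) = n - 1 - i.1 := by
  have := i.2
  rw [Finset.sum_boole, Finset.filter_lt_eq_Ioi, Fin.card_Ioi]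
  omega

theorem neg_le_sum_lengthChange (w : SignedPerm n) {i j : Fin n} (h : i < j) (a b : Letter n) :
    -(2 * (n : ℤ) - i.1 - j.1 - 3) ≤
      ∑ m ∈ (Finset.univ.erase i).erase j, lengthChange i j m a b (value w m) := by
  refine le_trans (le_of_eq ?_) (Finset.sum_le_sum fun m _ => neg_le_lengthChange i j m a b _)
  have htotal : ∑ m : Fin n, (((if i < m then 1 else 0) + (if j < m then 1 else 0) : ℤ)) =
      2 * (n : ℤ) - i.1 - j.1 - 2 := by
    rw [Finset.sum_add_distrib, sum_ite_lt, sum_ite_lt]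
    ring
  rw [← Finset.add_sum_erase _ _ (Finset.mem_univ i),
    ← Finset.add_sum_erase _ _ (Finset.mem_erase.2 ⟨h.ne', Finset.mem_univ j⟩)] at htotal
  simp only [lt_self_iff_false, if_false, h, if_true, h.not_gt] at htotal
  rw [Finset.sum_neg_distrib]
  linarith

variable {w : SignedPerm n} {i j : Fin n}

theorem sum_lengthChange_eq_zero_iff (h : i < j) (hlt : value w i < bar (value w j)) :
    ∑ m ∈ (Finset.univ.erase i).erase j,
        lengthChange i j m (value w i) (bar (value w j)) (value w m) = 0 ↔
      (∀ m, i < m → m < j → value w m ∉ Ioo (value w i) (bar (value w j))) ∧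
      ∀ m, j < m → value w m ∉ Ioo (value w i) (bar (value w j)) ∧
        value w m ∉ Ioo (value w j) (bar (value w i)) := by
  rw [Finset.sum_eq_zero_iff_of_nonneg fun m _ => lengthChange_nonneg i j m hlt.le _]
  have hzero (m : Fin n) (hi : m ≠ i) (hj : m ≠ j) :
      lengthChange i j m (value w i) (bar (value w j)) (value w m) = 0 ↔
        (i < m → value w m ∉ Ioo (value w i) (bar (value w j))) ∧
        (j < m → value w m ∉ Ioo (value w j) (bar (value w i))) := by
    have hmi := (value_injective w).ne hi
    have hmj := (value_injective w).ne hj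
    have hmi' := value_ne_bar_value w m i
    rw [lengthChange_eq_zero_iff hlt]
    grind
  simp only [Finset.mem_erase, Finset.mem_univ, and_true]
  constructor
  · intro hsum
    exact ⟨fun m him hmj => ((hzero m him.ne' hmj.ne).1 (hsum m ⟨hmj.ne, him.ne'⟩)).1 him,
      fun m hjm => have him := h.trans hjm
        ((hzero m him.ne' hjm.ne').1 (hsum m ⟨hjm.ne', him.ne'⟩)).imp (· him) (· hjm)⟩
  · rintro ⟨hbetween, hbeyond⟩ m ⟨hmj, hmi⟩
    refine (hzero m hmi hmj).2 ⟨fun him => ?_, fun hjm => (hbeyond m hjm).2⟩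
    exact hmj.lt_or_gt.elim (hbetween m him) fun hjm => (hbeyond m hjm).1

theorem step_mul_refl_iff (h : i < j) :
    Step w i j (w * (PosRoot.plus i j h).refl) ↔
      value w i < bar (value w j) ∧ (IsUnbarred (value w i) ↔ IsUnbarred (bar (value w j))) ∧
      ∑ m ∈ (Finset.univ.erase i).erase j,
        lengthChange i j m (value w i) (bar (value w j)) (value w m) = 0 := by
  have hl := value_mul_refl_left w h
  have hr := value_mul_refl_right w h
  constructor
  · intro s
    have hlt := hl ▸ s.value_lt
    refine ⟨hlt, hl ▸ s.side, (sum_lengthChange_eq_zero_iff h hlt).2 ?_⟩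
    rw [← hl, ← hr]
    exact ⟨s.between, s.beyond⟩
  · rintro ⟨hlt, hside, hsum⟩
    rw [sum_lengthChange_eq_zero_iff h hlt, ← hl, ← hr] at hsum
    exact ⟨h, hl, hr, fun m => value_mul_refl_of_ne w h, hl ▸ hlt, hl ▸ hside, hsum.1, hsum.2⟩

theorem Step.eq_mul_refl {w' : SignedPerm n} (s : Step w i j w') (h : i < j) :
    w' = w * (PosRoot.plus i j h).refl := by
  refine eq_of_value_eq fun m => ?_
  by_cases hi : m = i
  · rw [hi, s.left, value_mul_refl_left]
  by_cases hj : m = j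
  · rw [hj, s.right, value_mul_refl_right]
  rw [s.of_ne m hi hj, value_mul_refl_of_ne w h hi hj]

theorem qbEdge_mul_refl_iff (h : i < j) :
    QBEdge w (.plus i j h) (w * (PosRoot.plus i j h).refl) ↔
      Step w i j (w * (PosRoot.plus i j h).refl) := by
  have hlength := length_mul_refl w h
  have hsum_ge := neg_le_sum_lengthChange w h (value w i) (bar (value w j))
  rw [QBEdge, and_iff_right rfl, rho_dotProduct_coroot_plus, step_mul_refl_iff h]
  have := j.2
  by_cases hlt : value w i < bar (value w j)
  · have hsum_nonneg := Finset.sum_nonneg fun m (_ : m ∈ (Finset.univ.erase i).erase j) =>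
      lengthChange_nonneg i j m hlt.le (value w m)
    grind
  · have hsum_nonpos := Finset.sum_nonpos fun m (_ : m ∈ (Finset.univ.erase i).erase j) =>
      lengthChange_nonpos i j m (not_lt.1 hlt) (value w m)
    grind

theorem qbEdge_plus_iff {w' : SignedPerm n} (h : i < j) :
    QBEdge w (.plus i j h) w' ↔ Step w i j w' := by
  constructor
  · intro hedge
    obtain rfl := hedge.1
    exact (qbEdge_mul_refl_iff h).1 hedge
  · intro s
    obtain rfl := s.eq_mul_refl h
    exact (qbEdge_mul_refl_iff h).2 s

end Edges

section RootSequences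

variable {n : ℕ}

/-- The roots `(j, ī), …, (1, ī)`, an initial part of `Γ_i` in reverse order. -/
def segment (i : Fin n) : (j : ℕ) → j ≤ i.1 → List (PosRoot n)
  | 0, _ => []
  | j + 1, h => .plus ⟨j, by omega⟩ i h :: segment i j (by omega)

/-- The reverse of `Γ_r(k)`, by recursion on `k`. -/
def revGamma (n : ℕ) : (k : ℕ) → k ≤ n → List (PosRoot n)
  | 0, _ => []
  | k + 1, h => segment ⟨k, h⟩ k le_rfl ++ revGamma n k (by omega)

theorem segment_eq_reverse_map (i : Fin n) (j : ℕ) (hj : j ≤ i.1) :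
    segment i j hj = ((List.finRange j).map fun q : Fin j => PosRoot.plus ⟨q.1, by omega⟩ i
      (by simp only [Fin.lt_def]; omega)).reverse := by
  induction j with
  | zero => rfl
  | succ j ih =>
    rw [List.finRange_succ_last, segment, ih]
    simp [List.map_map, Function.comp_def]

theorem reverse_GammaR {k : ℕ} (hk : k ≤ n) : (GammaR k hk).reverse = revGamma n k hk := by
  induction k with
  | zero => rfl
  | succ k ih =>
    rw [revGamma, ← ih, segment_eq_reverse_map, ← List.reverse_append]
    congr 1
    simp only [GammaR, List.finRange_succ_last, List.flatMap_append, List.flatMap_map]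
    simp

theorem exists_eq_plus_of_mem_segment {i : Fin n} {j : ℕ} {hj : j ≤ i.1} {α : PosRoot n}
    (hα : α ∈ segment i j hj) : ∃ (q : Fin n) (h : q < i), α = .plus q i h ∧ q.1 < j := by
  induction j with
  | zero => cases hα
  | succ j ih =>
    rcases List.mem_cons.1 hα with rfl | hα
    · exact ⟨_, _, rfl, j.lt_succ_self⟩
    · obtain ⟨q, h, hq, hqj⟩ := ih hα
      exact ⟨q, h, hq, hqj.trans j.lt_succ_self⟩

theorem exists_eq_plus_of_mem_revGamma {k : ℕ} {hk : k ≤ n} {α : PosRoot n}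
    (hα : α ∈ revGamma n k hk) : ∃ (i j : Fin n) (h : i < j), α = .plus i j h ∧ j.1 < k := by
  induction k with
  | zero => cases hα
  | succ k ih =>
    rcases List.mem_append.1 hα with hα | hα
    · obtain ⟨q, h, rfl, -⟩ := exists_eq_plus_of_mem_segment hα
      exact ⟨q, _, h, rfl, k.lt_succ_self⟩
    · obtain ⟨i, j, h, rfl, hj⟩ := ih hα
      exact ⟨i, j, h, rfl, hj.trans k.lt_succ_self⟩

end RootSequences

section Reach

variable {n : ℕ} {L M : List (PosRoot n)} {u v w : SignedPerm n}

/-- There is a path from `u` to `v` in the quantum Bruhat graph whose labels form a subsequence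
of `L`. -/
def Reach (L : List (PosRoot n)) (u v : SignedPerm n) : Prop :=
  ∃ P, IsQBPath u P ∧ endpoint u P = v ∧ (labels P).Sublist L

theorem exists_isRightPath_iff {k : ℕ} {hk : k ≤ n} {C' : Fin k → Letter n} :
    (∃ P, IsRightPath hk u C' P) ↔ ∃ v, Reach (revGamma n k hk) u v ∧ window hk v = C' := by
  simp only [IsRightPath, Reach, reverse_GammaR]
  grind

theorem endpoint_cons (u : SignedPerm n) (x : PosRoot n × SignedPerm n)
    (P : List (PosRoot n × SignedPerm n)) : endpoint u (x :: P) = endpoint x.2 P := by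
  simp [endpoint, vertices, List.getLast_cons]

theorem reach_nil_iff : Reach [] u v ↔ u = v := by
  constructor
  · rintro ⟨P, -, hv, hP⟩
    obtain rfl : P = [] := List.map_eq_nil_iff.1 (List.sublist_nil.1 hP)
    exact hv
  · rintro rfl
    exact ⟨[], trivial, rfl, .slnil⟩

theorem reach_cons_iff {α : PosRoot n} :
    Reach (α :: L) u v ↔ Reach L u v ∨ ∃ w, QBEdge u α w ∧ Reach L w v := by
  constructor
  · rintro ⟨P, hP, hv, hL⟩
    rcases List.sublist_cons_iff.1 hL with hL | ⟨r, hr, hL⟩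
    · exact .inl ⟨P, hP, hv, hL⟩
    · match P, hr, hP, hv with
      | (β, w) :: P, hr, hP, hv =>
        obtain ⟨rfl, rfl⟩ := List.cons.inj hr
        exact .inr ⟨w, hP.1, P, hP.2, (endpoint_cons u _ P).symm.trans hv, hL⟩
  · rintro (⟨P, hP, hv, hL⟩ | ⟨w, hw, P, hP, hv, hL⟩)
    · exact ⟨P, hP, hv, hL.cons α⟩
    · exact ⟨(α, w) :: P, ⟨hw, hP⟩, (endpoint_cons u _ P).trans hv, hL.cons_cons α⟩

theorem reach_append_iff : Reach (L ++ M) u v ↔ ∃ w, Reach L u w ∧ Reach M w v := by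
  induction L generalizing u with
  | nil => simp [reach_nil_iff]
  | cons α L ih =>
    simp only [List.cons_append, reach_cons_iff, ih]
    grind

theorem reach_segment_succ_iff {i : Fin n} {j : ℕ} {hj : j + 1 ≤ i.1} :
    Reach (segment i (j + 1) hj) u v ↔ Reach (segment i j (by omega)) u v ∨
      ∃ w, Step u ⟨j, by omega⟩ i w ∧ Reach (segment i j (by omega)) w v := by
  simp only [segment, reach_cons_iff, qbEdge_plus_iff]

theorem Reach.rel {r : SignedPerm n → SignedPerm n → Prop} [Std.Refl r] [IsTrans _ r]
    (h : Reach L u v) (hr : ∀ α ∈ L, ∀ w w', QBEdge w α w' → r w w') : r u v := by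
  induction L generalizing u with
  | nil =>
    obtain rfl := reach_nil_iff.1 h
    exact refl_of r u
  | cons α L ih =>
    have ih' {w} (hw : Reach L w v) := ih hw fun β hβ => hr β (List.mem_cons_of_mem α hβ)
    rcases reach_cons_iff.1 h with h | ⟨w, hw, h⟩
    · exact ih' h
    · exact trans_of r (hr α List.mem_cons_self u w hw) (ih' h)

theorem isChain_vertices {r : SignedPerm n → SignedPerm n → Prop}
    {P : List (PosRoot n × SignedPerm n)} (hP : IsQBPath u P)
    (hr : ∀ α ∈ labels P, ∀ w w', QBEdge w α w' → r w w') : (vertices u P).IsChain r := by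
  induction P generalizing u with
  | nil => exact List.isChain_singleton u
  | cons x P ih =>
    exact List.isChain_cons_cons.2 ⟨hr _ List.mem_cons_self _ _ hP.1,
      ih hP.2 fun α hα => hr α (List.mem_cons_of_mem _ hα)⟩

end Reach

section Ascents

variable {n m : ℕ}

/-- The letter `y` or its bar is an entry of the column `C`. -/
def MemAbs (C : Fin m → Letter n) (y : Letter n) : Prop := ∃ p, C p = y ∨ C p = bar y

/-- The entries of `C'` are obtained from those of `C` by moving up inside `[n]` and inside its
complement, without changing the set of absolute values and without passing any letter whose
absolute value does not occur. -/
structure Ascent (C C' : Fin m → Letter n) : Prop where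
  le : ∀ p, C p ≤ C' p
  side : ∀ p, IsUnbarred (C p) ↔ IsUnbarred (C' p)
  memAbs_iff : ∀ y, MemAbs C y ↔ MemAbs C' y
  not_cross : ∀ y, ¬MemAbs C y → ∀ p, y ∉ Ioc (C p) (C' p)

/-- The column `C'` avoids `C`: no later entry of `C'` lies in `[C(i), C'(i))`. For columns with
`C(i) ≤ C'(i)` for all `i` this is Condition 1'. -/
def Avoids (C C' : Fin m → Letter n) : Prop := ∀ i l, i < l → C' l ∉ Ico (C i) (C' i)

theorem memAbs_window_iff {hm : m ≤ n} {w : SignedPerm n} {y : Letter n} :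
    MemAbs (window hm w) y ↔ ∃ i : Fin n, i.1 < m ∧ (value w i = y ∨ value w i = bar y) :=
  ⟨fun ⟨p, hp⟩ => ⟨Fin.castLE hm p, p.2, hp⟩, fun ⟨i, hi, hy⟩ => ⟨⟨i, hi⟩, hy⟩⟩

theorem not_memAbs_window {hm : m ≤ n} {w : SignedPerm n} {q : Fin n} (hq : m ≤ q.1)
    {y : Letter n} (hy : value w q = y ∨ value w q = bar y) : ¬MemAbs (window hm w) y := by
  rw [memAbs_window_iff]
  rintro ⟨i, hi, hiy⟩
  have hiq : i ≠ q := by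
    rintro rfl
    omega
  have hne := (value_injective w).ne hiq
  have hne' := value_ne_bar_value w i q
  grind

theorem exists_value_of_not_memAbs_window {hm : m ≤ n} {w : SignedPerm n} {y : Letter n}
    (hy : ¬MemAbs (window hm w) y) :
    ∃ q : Fin n, m ≤ q.1 ∧ (value w q = y ∨ value w q = bar y) := by
  obtain ⟨q, hq⟩ := exists_value_eq_or_eq_bar w y
  exact ⟨q, not_lt.1 fun hqm => hy (memAbs_window_iff.2 ⟨q, hqm, hq⟩), hq⟩

theorem Ascent.refl (C : Fin m → Letter n) : Ascent C C :=
  ⟨fun _ => le_rfl, fun _ => Iff.rfl, fun _ => Iff.rfl, fun y _ p => by simp⟩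

theorem Ascent.trans {C C' C'' : Fin m → Letter n} (h : Ascent C C') (h' : Ascent C' C'') :
    Ascent C C'' := by
  refine ⟨fun p => (h.le p).trans (h'.le p), fun p => (h.side p).trans (h'.side p),
    fun y => (h.memAbs_iff y).trans (h'.memAbs_iff y), fun y hy p hp => ?_⟩
  rcases le_or_gt y (C' p) with hle | hlt
  · exact h.not_cross y hy p ⟨hp.1, hle⟩
  · exact h'.not_cross y (mt (h.memAbs_iff y).2 hy) p ⟨hlt, hp.2⟩

instance (hm : m ≤ n) : Std.Refl fun w w' : SignedPerm n => Ascent (window hm w) (window hm w') :=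
  ⟨fun w => .refl (window hm w)⟩

instance (hm : m ≤ n) :
    IsTrans _ fun w w' : SignedPerm n => Ascent (window hm w) (window hm w') :=
  ⟨fun _ _ _ => .trans⟩

namespace Step

variable {w w' : SignedPerm n} {i j : Fin n} (s : Step w i j w')
include s

theorem value_lt_right : value w j < value w' j := by
  have := s.left
  have := s.right
  have := s.value_lt
  grind

theorem value_le (p : Fin n) : value w p ≤ value w' p := by
  by_cases hi : p = i
  · exact hi ▸ s.value_lt.le
  by_cases hj : p = j
  · exact hj ▸ s.value_lt_right.le
  exact (s.of_ne p hi hj).ge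

theorem isUnbarred_iff (p : Fin n) : IsUnbarred (value w p) ↔ IsUnbarred (value w' p) := by
  have := s.left
  have := s.right
  have := s.side
  by_cases hi : p = i
  · grind
  by_cases hj : p = j
  · grind
  rw [s.of_ne p hi hj]

theorem memAbs_window_iff {m : ℕ} (hm : m ≤ n) (hj : j.1 < m) (y : Letter n) :
    MemAbs (window hm w) y ↔ MemAbs (window hm w') y := by
  have hl := s.left
  have hr := s.right
  have hi : i.1 < m := (Fin.lt_def.1 s.lt).trans hj
  simp only [TypeC.memAbs_window_iff]
  constructor
  all_goals
    rintro ⟨q, hq, hy⟩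
    by_cases hqi : q = i
    · exact ⟨j, hj, by grind⟩
    by_cases hqj : q = j
    · exact ⟨i, hi, by grind⟩
    exact ⟨q, hq, by grind [s.of_ne q hqi hqj]⟩

theorem not_mem_Ioc {m : ℕ} {hm : m ≤ n} (hj : j.1 < m) {y : Letter n}
    (hy : ¬MemAbs (window hm w) y) (p : Fin n) : y ∉ Ioc (value w p) (value w' p) := by
  obtain ⟨q, hmq, hq⟩ := exists_value_of_not_memAbs_window hy
  have hjq : j < q := Fin.lt_def.2 (by omega)
  have hiq := (value_injective w).ne (s.lt.trans hjq).ne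
  have hjq' := (value_injective w).ne hjq.ne
  have hiq' := value_ne_bar_value w i q
  have hjq'' := value_ne_bar_value w j q
  have hbeyond := s.beyond q hjq
  have hl := s.left
  have hr := s.right
  by_cases hi : p = i
  · grind
  by_cases hj : p = j
  · grind
  rw [s.of_ne p hi hj]
  simp

theorem ascent {m : ℕ} (hm : m ≤ n) (hj : j.1 < m) : Ascent (window hm w) (window hm w') :=
  ⟨fun p => s.value_le (Fin.castLE hm p), fun p => s.isUnbarred_iff (Fin.castLE hm p),
    s.memAbs_window_iff hm hj, fun _ hy p => s.not_mem_Ioc hj hy (Fin.castLE hm p)⟩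

end Step

theorem isChain_ascent {k : ℕ} {hk : k ≤ n} {u : SignedPerm n} {C' : Fin k → Letter n}
    {P : List (PosRoot n × SignedPerm n)} (hP : IsRightPath hk u C' P) :
    (vertices u P).IsChain fun w w' => Ascent (window hk w) (window hk w') := by
  refine isChain_vertices hP.1 fun α hα w w' hw => ?_
  obtain ⟨i, j, h, rfl, hj⟩ :=
    exists_eq_plus_of_mem_revGamma (reverse_GammaR hk ▸ hP.2.2.subset hα)
  exact ((qbEdge_plus_iff h).1 hw).ascent hk hj

variable {u v : SignedPerm n}

theorem Reach.segment_ascent {i : Fin n} {j : ℕ} {hj : j ≤ i.1} (h : Reach (segment i j hj) u v)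
    (hm : m ≤ n) (him : i.1 < m) : Ascent (window hm u) (window hm v) := by
  refine h.rel (r := fun u v => Ascent (window hm u) (window hm v)) fun α hα w w' hw => ?_
  obtain ⟨q, hq, rfl, -⟩ := exists_eq_plus_of_mem_segment hα
  exact ((qbEdge_plus_iff hq).1 hw).ascent hm him

theorem Reach.revGamma_ascent {k : ℕ} {hk : k ≤ n} (h : Reach (revGamma n k hk) u v)
    (hm : m ≤ n) (hkm : k ≤ m) : Ascent (window hm u) (window hm v) := by
  refine h.rel (r := fun u v => Ascent (window hm u) (window hm v)) fun α hα w w' hw => ?_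
  obtain ⟨i, j, hij, rfl, hj⟩ := exists_eq_plus_of_mem_revGamma hα
  exact ((qbEdge_plus_iff hij).1 hw).ascent hm (by omega)

theorem Reach.value_eq_of_revGamma {k : ℕ} {hk : k ≤ n} (h : Reach (revGamma n k hk) u v)
    {p : Fin n} (hp : k ≤ p.1) : value v p = value u p := by
  let r (u v : SignedPerm n) : Prop := value v p = value u p
  have : Std.Refl r := ⟨fun _ => rfl⟩
  have : IsTrans _ r := ⟨fun _ _ _ h h' => Eq.trans h' h⟩
  refine h.rel (r := r) fun α hα w w' hw => ?_
  obtain ⟨i, j, hij, rfl, hj⟩ := exists_eq_plus_of_mem_revGamma hα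
  have hpj : p ≠ j := by
    rintro rfl
    omega
  have hpi : p ≠ i := by
    rintro rfl
    exact absurd (Fin.lt_def.1 hij) (by omega)
  exact ((qbEdge_plus_iff hij).1 hw).of_ne p hpi hpj

end Ascents

section Segments

variable {n : ℕ} {i : Fin n} {j : ℕ} {hj : j ≤ i.1} {u v : SignedPerm n}

theorem Reach.value_le_of_segment (h : Reach (segment i j hj) u v) (p : Fin n) :
    value u p ≤ value v p :=
  (h.segment_ascent le_rfl i.2).le p

theorem Reach.value_eq_of_segment (h : Reach (segment i j hj) u v) {p : Fin n} (hp : j ≤ p.1)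
    (hpi : p ≠ i) : value v p = value u p := by
  let r (u v : SignedPerm n) : Prop := value v p = value u p
  have : Std.Refl r := ⟨fun _ => rfl⟩
  have : IsTrans _ r := ⟨fun _ _ _ h h' => Eq.trans h' h⟩
  refine h.rel (r := r) fun α hα w w' hw => ?_
  obtain ⟨q, hq, rfl, hqj⟩ := exists_eq_plus_of_mem_segment hα
  have hpq : p ≠ q := by
    rintro rfl
    omega
  exact ((qbEdge_plus_iff hq).1 hw).of_ne p hpq hpi

/-- A step that moved the value at `i` past the bar of the value at `q`, for a position `q` already
skipped, would violate `Step.between`. -/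
theorem Reach.not_mem_Ico_of_segment (h : Reach (segment i j hj) u v) {q : Fin n} (hq : j ≤ q.1)
    (hqi : q < i) : value u q ∉ Ico (bar (value v i)) (bar (value u i)) := by
  induction j generalizing u with
  | zero =>
    obtain rfl := reach_nil_iff.1 h
    simp
  | succ j ih =>
    rcases reach_segment_succ_iff.1 h with h | ⟨w, s, h⟩
    · exact ih h (Nat.le_of_succ_le hq)
    · have hjq : (⟨j, by omega⟩ : Fin n) < q := hq
      have hqw := ih h (Nat.le_of_succ_le hq)
      have hne := (value_injective u).ne hjq.ne'
      have hbetween := s.between q hjq hqi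
      have hl := s.left
      have hr := s.right
      rw [s.of_ne q hjq.ne' hqi.ne] at hqw
      grind

theorem Step.not_mem_Ico_of_segment {w : SignedPerm n} {q l : Fin n} (s : Step u q i w)
    (h : Reach (segment i j hj) w v) (hq : j = q.1) (hql : q < l) (hli : l < i) :
    value v l ∉ Ico (bar (value v i)) (value w q) := by
  have hjl : j ≤ l.1 := hq ▸ hql.le
  have hnot_skip := h.not_mem_Ico_of_segment hjl hli
  have hbetween := s.between l hql hli
  have hne := (value_injective u).ne hql.ne'
  have hr := s.right
  rw [h.value_eq_of_segment hjl hli.ne]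
  rw [s.of_ne l hql.ne' hli.ne] at hnot_skip ⊢
  grind

theorem Reach.changed_of_segment (h : Reach (segment i j hj) u v) {p : Fin n} (hpi : p < i)
    (hp : value u p < value v p) :
    bar (value v i) ≤ value u p ∧ value v p ≤ bar (value u i) ∧
      ∀ l, p < l → l < i → value v l ∉ Ico (bar (value v i)) (value v p) := by
  induction j generalizing u with
  | zero =>
    obtain rfl := reach_nil_iff.1 h
    exact absurd hp (lt_irrefl _)
  | succ j ih =>
    rcases reach_segment_succ_iff.1 h with h | ⟨w, s, h⟩
    · exact ih h hp
    · have hmono := h.value_le_of_segment i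
      have hlt := s.value_lt_right
      have hl := s.left
      have hr := s.right
      by_cases hpj : p.1 = j
      · subst hpj
        have hv := h.value_eq_of_segment le_rfl hpi.ne
        refine ⟨by grind, by grind, fun l hpl hli => ?_⟩
        exact hv ▸ s.not_mem_Ico_of_segment h rfl hpl hli
      · have hup := s.of_ne p (fun hp => hpj (congrArg Fin.val hp)) hpi.ne
        obtain ⟨hlow, hhigh, hlater⟩ := ih h (hup ▸ hp)
        exact ⟨by grind, by grind, hlater⟩

end Segments

section Avoidance

variable {n : ℕ} {u v w : SignedPerm n}

theorem not_mem_Ico_last {k : ℕ} {hk : k < n} (h : Reach (segment ⟨k, hk⟩ k le_rfl) u w)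
    (h' : Reach (revGamma n k hk.le) w v) {i : Fin n} (hik : i.1 < k) :
    value w ⟨k, hk⟩ ∉ Ico (value u i) (value v i) := by
  have ha := h'.revGamma_ascent hk.le le_rfl
  have hne := (value_injective w).ne (show i ≠ ⟨k, hk⟩ from Fin.ne_of_lt hik)
  have hside : IsUnbarred (value u i) ↔ IsUnbarred (value w i) :=
    (h.segment_ascent le_rfl hk).side i
  have hside' : IsUnbarred (value u ⟨k, hk⟩) ↔ IsUnbarred (value w ⟨k, hk⟩) :=
    (h.segment_ascent le_rfl hk).side ⟨k, hk⟩
  have hcross : value w ⟨k, hk⟩ ∉ Ioc (value w i) (value v i) :=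
    ha.not_cross _ (not_memAbs_window (q := ⟨k, hk⟩) le_rfl (.inl rfl)) ⟨i, hik⟩
  rcases (h.value_le_of_segment i).eq_or_lt with heq | hlt
  · grind
  · obtain ⟨hlow, hhigh, -⟩ := h.changed_of_segment (p := i) hik hlt
    grind

theorem not_mem_Ico_of_lt_last {k : ℕ} {hk : k < n} (h : Reach (segment ⟨k, hk⟩ k le_rfl) u w)
    (h' : Reach (revGamma n k hk.le) w v) {i l : Fin n} (hil : i < l) (hlk : l.1 < k)
    (havoid : value v l ∉ Ico (value w i) (value v i)) :
    value v l ∉ Ico (value u i) (value v i) := by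
  rintro ⟨hle, hlt⟩
  have hik : i.1 < k := (Fin.lt_def.1 hil).trans hlk
  have hwl : value v l < value w i := by grind
  obtain ⟨hlow, -, hlater⟩ := h.changed_of_segment (p := i) hik (hle.trans_lt hwl)
  have ha := h'.revGamma_ascent hk.le le_rfl
  have hwv : value w l ≤ value v l := ha.le ⟨l, hlk⟩
  have hcross : bar (value w ⟨k, hk⟩) ∉ Ioc (value w l) (value v l) :=
    ha.not_cross _ (not_memAbs_window (q := ⟨k, hk⟩) le_rfl (.inr (bar_bar _).symm)) ⟨l, hlk⟩
  have hwl_low := hlater l hil hlk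
  grind

theorem Reach.avoids {k : ℕ} {hk : k ≤ n} (h : Reach (revGamma n k hk) u v) :
    Avoids (window hk u) (window hk v) := by
  induction k generalizing u with
  | zero => exact fun i => i.elim0
  | succ k ih =>
    obtain ⟨w, h, h'⟩ := reach_append_iff.1 h
    intro i l hil
    obtain ⟨i, rfl⟩ | rfl := i.eq_castSucc_or_eq_last
    · obtain ⟨l, rfl⟩ | rfl := l.eq_castSucc_or_eq_last
      · exact not_mem_Ico_of_lt_last h h' hil l.2 (ih h' i l hil)
      · have hv := h'.value_eq_of_revGamma (p := ⟨k, hk⟩) le_rfl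
        have hlast := not_mem_Ico_last h h' (i := i.castLE (Nat.le_of_succ_le hk)) i.2
        rw [← hv] at hlast
        exact hlast
    · exact absurd (Fin.le_last l) hil.not_ge

end Avoidance

section Uniqueness

variable {n : ℕ}

/-- Among the paths with labels in `L` from a given vertex, a path is determined by the value of
`f` at its endpoint. -/
def Separates {β : Type*} (f : SignedPerm n → β) (L : List (PosRoot n)) : Prop :=
  ∀ u P Q, IsQBPath u P → IsQBPath u Q → (labels P).Sublist L → (labels Q).Sublist L →
    f (endpoint u P) = f (endpoint u Q) → P = Q

variable {β : Type*} {f : SignedPerm n → β} {L : List (PosRoot n)}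

theorem Separates.of_factor {γ : Type*} {g : SignedPerm n → γ} (h : Separates f L)
    (hfg : ∀ v v', g v = g v' → f v = f v') : Separates g L :=
  fun u P Q hP hQ hPL hQL hPQ => h u P Q hP hQ hPL hQL (hfg _ _ hPQ)

theorem separates_nil : Separates f [] := by
  intro u P Q _ _ hP hQ _
  rw [List.map_eq_nil_iff.1 (List.sublist_nil.1 hP), List.map_eq_nil_iff.1 (List.sublist_nil.1 hQ)]

theorem sublist_cons_cases {α : PosRoot n} {P : List (PosRoot n × SignedPerm n)}
    (h : (labels P).Sublist (α :: L)) :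
    (labels P).Sublist L ∨ ∃ w P', P = (α, w) :: P' ∧ (labels P').Sublist L := by
  rcases List.sublist_cons_iff.1 h with h | ⟨r, hr, h⟩
  · exact .inl h
  · obtain ⟨⟨_, w⟩, P', rfl, rfl, rfl⟩ := List.map_eq_cons_iff.1 hr
    exact .inr ⟨w, P', rfl, h⟩

theorem Separates.cons {α : PosRoot n} (h : Separates f L)
    (hα : ∀ u w v v', QBEdge u α w → Reach L w v → Reach L u v' → f v ≠ f v') :
    Separates f (α :: L) := by
  intro u P Q hP hQ hPL hQL hPQ
  rcases sublist_cons_cases hPL with hPL' | ⟨w, P', rfl, hPL'⟩ <;>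
    rcases sublist_cons_cases hQL with hQL' | ⟨w', Q', rfl, hQL'⟩
  · exact h u P Q hP hQ hPL' hQL' hPQ
  · rw [endpoint_cons] at hPQ
    exact (hα u w' _ _ hQ.1 ⟨Q', hQ.2, rfl, hQL'⟩ ⟨P, hP, rfl, hPL'⟩ hPQ.symm).elim
  · rw [endpoint_cons] at hPQ
    exact (hα u w _ _ hP.1 ⟨P', hP.2, rfl, hPL'⟩ ⟨Q, hQ, rfl, hQL'⟩ hPQ).elim
  · obtain rfl : w = w' := hP.1.1.trans hQ.1.1.symm
    rw [endpoint_cons, endpoint_cons] at hPQ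
    rw [h w P' Q' hP.2 hQ.2 hPL' hQL' hPQ]

theorem Step.value_ne_of_reach {u w v v' : SignedPerm n} {k j : ℕ} {hk : k < n} {hj : j < k}
    (s : Step u ⟨j, hj.trans hk⟩ ⟨k, hk⟩ w)
    (h : Reach (segment ⟨k, hk⟩ j hj.le ++ revGamma n k hk.le) w v)
    (h' : Reach (segment ⟨k, hk⟩ j hj.le ++ revGamma n k hk.le) u v') :
    value v ⟨k, hk⟩ ≠ value v' ⟨k, hk⟩ := by
  obtain ⟨x, hx, hxv⟩ := reach_append_iff.1 h
  obtain ⟨x', hx', hxv'⟩ := reach_append_iff.1 h'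
  rw [hxv.value_eq_of_revGamma le_rfl, hxv'.value_eq_of_revGamma le_rfl]
  have hnot_skip := hx'.not_mem_Ico_of_segment (q := ⟨j, hj.trans hk⟩) le_rfl hj
  have hle := hx.value_le_of_segment ⟨k, hk⟩
  have hr := s.right
  have hlt := s.value_lt_right
  grind

theorem separates_revGamma (k : ℕ) (hk : k ≤ n) : Separates (window hk) (revGamma n k hk) := by
  induction k with
  | zero => exact separates_nil
  | succ k ih =>
    suffices h : ∀ j (hj : j ≤ k), Separates (window hk)
        (segment ⟨k, hk⟩ j hj ++ revGamma n k (Nat.le_of_succ_le hk)) from h k le_rfl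
    intro j hj
    induction j with
    | zero =>
      exact (ih _).of_factor fun v v' hv => funext fun p => congrFun hv p.castSucc
    | succ j ihj =>
      refine (ihj _).cons fun u w v v' hw h h' hv => ?_
      have s := (qbEdge_plus_iff _).1 hw
      exact s.value_ne_of_reach (hj := hj) h h' (congrFun hv (Fin.last k))

end Uniqueness

section Columns

variable {n m : ℕ} {C C' : Fin m → Letter n}

theorem IsColumn.eq_of_eq_or_eq_bar (hC : IsColumn C) {p q : Fin m}
    (h : C p = C q ∨ C p = bar (C q)) : p = q :=
  hC (absLetter_eq_iff.2 h)

theorem IsColumn.injective (hC : IsColumn C) : Function.Injective C :=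
  fun _ _ h => hC.eq_of_eq_or_eq_bar (.inl h)

theorem isColumn_window (hm : m ≤ n) (w : SignedPerm n) : IsColumn (window hm w) := by
  intro p q hpq
  rcases absLetter_eq_iff.1 hpq with h | h
  · exact Fin.castLE_injective hm (value_injective w h)
  · exact absurd h (value_ne_bar_value w _ _)

theorem IsColumn.init {C : Fin (m + 1) → Letter n} (hC : IsColumn C) : IsColumn (Fin.init C) :=
  hC.comp (Fin.castSucc_injective m)

theorem memAbs_bar {y : Letter n} : MemAbs C (bar y) ↔ MemAbs C y := by
  simp only [MemAbs, bar_bar, or_comm]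

theorem IsColumn.memAbs_init_iff {C : Fin (m + 1) → Letter n} (hC : IsColumn C) {y : Letter n} :
    MemAbs (Fin.init C) y ↔
      MemAbs C y ∧ ¬(C (Fin.last m) = y ∨ C (Fin.last m) = bar y) := by
  constructor
  · rintro ⟨p, hp⟩
    refine ⟨⟨p.castSucc, hp⟩, fun hlast => ?_⟩
    have hne := mt (hC.eq_of_eq_or_eq_bar (p := p.castSucc) (q := Fin.last m)) p.castSucc_lt_last.ne
    simp only [Fin.init] at hp
    grind
  · rintro ⟨⟨p, hp⟩, hlast⟩
    obtain ⟨p, rfl⟩ | rfl := p.eq_castSucc_or_eq_last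
    · exact ⟨p, hp⟩
    · exact absurd hp hlast

/-- The number of entries of `C` that are at least `y`. The threshold is a natural number, not a
letter, so that the symmetry `y ↦ 2n - y` needs no boundary cases. -/
def countGE (C : Fin m → Letter n) (y : ℕ) : ℕ := (Finset.univ.filter fun p => y ≤ (C p).1).card

theorem countGE_le {y : ℕ} (h : ∀ p, y ≤ (C p).1 → y ≤ (C' p).1) : countGE C y ≤ countGE C' y :=
  Finset.card_le_card (Finset.monotone_filter_right _ fun p _ => h p)

theorem countGE_lt {y : ℕ} (h : ∀ p, y ≤ (C p).1 → y ≤ (C' p).1) {q : Fin m} (hq : (C q).1 < y)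
    (hq' : y ≤ (C' q).1) : countGE C y < countGE C' y := by
  refine Finset.card_lt_card (Finset.ssubset_iff_subset_ne.2
    ⟨Finset.monotone_filter_right _ fun p _ => h p, fun heq => ?_⟩)
  have hmem : q ∈ Finset.univ.filter fun p => y ≤ (C p).1 := by simpa [heq] using hq'
  exact hq.not_ge (Finset.mem_filter.1 hmem).2

theorem countGE_eq_sum (y : ℕ) : countGE C y = ∑ p, if y ≤ (C p).1 then 1 else 0 :=
  Finset.card_filter _ _

theorem card_eq_countGE_add (C : Fin m → Letter n) (y : ℕ) :
    m = countGE C (2 * n - y) + (Finset.univ.filter fun p => y ≤ (bar (C p)).1).card := by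
  have hneg : (Finset.univ.filter fun p => y ≤ (bar (C p)).1) =
      Finset.univ.filter fun p => ¬2 * n - y ≤ (C p).1 :=
    Finset.filter_congr fun p _ => by grind
  rw [hneg, countGE, Finset.card_filter_add_card_filter_not, Finset.card_univ, Fintype.card_fin]

open Classical in
theorem IsColumn.countGE_add (hC : IsColumn C) (y : ℕ) :
    countGE C y + m = countGE C (2 * n - y) +
      (Finset.univ.filter fun v : Letter n => y ≤ v.1 ∧ MemAbs C v).card := by
  have hbars : (Finset.univ.filter fun v : Letter n => y ≤ v.1 ∧ MemAbs C v) =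
      (Finset.univ.filter fun p => y ≤ (C p).1).image C ∪
        (Finset.univ.filter fun p => y ≤ (bar (C p)).1).image (bar ∘ C) := by
    ext v
    have hbar (p : Fin m) : C p = bar v ↔ bar (C p) = v := by grind
    simp only [MemAbs, Finset.mem_union, Finset.mem_image, Finset.mem_filter, Finset.mem_univ,
      true_and, Function.comp_apply]
    grind
  have hdisj : Disjoint ((Finset.univ.filter fun p => y ≤ (C p).1).image C)
      ((Finset.univ.filter fun p => y ≤ (bar (C p)).1).image (bar ∘ C)) := by
    simp only [Finset.disjoint_left, Finset.mem_image]
    rintro _ ⟨p, -, rfl⟩ ⟨q, -, hqp⟩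
    obtain rfl := hC.eq_of_eq_or_eq_bar (.inr hqp.symm)
    exact bar_ne_self _ hqp
  rw [hbars, Finset.card_union_of_disjoint hdisj, Finset.card_image_of_injective _ hC.injective,
    Finset.card_image_of_injective _ (bar_injective.comp hC.injective), add_left_comm, ← countGE]
  exact congrArg _ (card_eq_countGE_add C y)

theorem countGE_add_countGE_sub (hC : IsColumn C) (hC' : IsColumn C')
    (habs : ∀ y, MemAbs C y ↔ MemAbs C' y) (y : ℕ) :
    countGE C y + countGE C' (2 * n - y) = countGE C' y + countGE C (2 * n - y) := by
  classical
  have h := hC.countGE_add y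
  have h' := hC'.countGE_add y
  simp only [habs] at h
  omega

end Columns

section SegmentCount

variable {n m : ℕ}

theorem countGE_add_of_eq_off {C C' : Fin m → Letter n} {p q : Fin m} (hpq : p ≠ q)
    (h : ∀ l, l ≠ p → l ≠ q → C' l = C l) (y : ℕ) :
    countGE C' y + ((if y ≤ (C p).1 then 1 else 0) + if y ≤ (C q).1 then 1 else 0) =
      countGE C y + ((if y ≤ (C' p).1 then 1 else 0) + if y ≤ (C' q).1 then 1 else 0) := by
  have hrest : ∑ l ∈ (Finset.univ.erase p).erase q, (if y ≤ (C' l).1 then 1 else 0) =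
      ∑ l ∈ (Finset.univ.erase p).erase q, if y ≤ (C l).1 then 1 else 0 := by
    refine Finset.sum_congr rfl fun l hl => ?_
    simp only [Finset.mem_erase, Finset.mem_univ, and_true] at hl
    rw [h l hl.2 hl.1]
  have hsplit (f : Fin m → ℕ) :
      ∑ l, f l = f p + (f q + ∑ l ∈ (Finset.univ.erase p).erase q, f l) := by
    rw [Finset.add_sum_erase _ f (Finset.mem_erase.2 ⟨hpq.symm, Finset.mem_univ q⟩),
      Finset.add_sum_erase _ f (Finset.mem_univ p)]
  rw [countGE_eq_sum, countGE_eq_sum, hsplit, hsplit fun l => if y ≤ (C l).1 then 1 else 0, hrest]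
  ring

theorem Step.countGE_window {w w' : SignedPerm n} {i j : Fin n} (s : Step w i j w') (hm : m ≤ n)
    (hj : j.1 < m) (y : ℕ) :
    countGE (window hm w') y = countGE (window hm w) y +
      (if (value w i).1 < y ∧ y ≤ (value w' i).1 then 1 else 0) +
      if (value w j).1 < y ∧ y ≤ (value w' j).1 then 1 else 0 := by
  have hij := Fin.lt_def.1 s.lt
  have hle := Fin.le_def.1 (s.value_le i)
  have hle' := Fin.le_def.1 (s.value_le j)
  have hoff (l : Fin m) (hi : l ≠ ⟨i, hij.trans hj⟩) (hj : l ≠ ⟨j, hj⟩) :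
      window hm w' l = window hm w l :=
    s.of_ne (Fin.castLE hm l) (fun h => hi (Fin.ext (Fin.ext_iff.1 h :)))
      fun h => hj (Fin.ext (Fin.ext_iff.1 h :))
  have h : countGE (window hm w') y +
      ((if y ≤ (value w i).1 then 1 else 0) + if y ≤ (value w j).1 then 1 else 0) =
      countGE (window hm w) y +
        ((if y ≤ (value w' i).1 then 1 else 0) + if y ≤ (value w' j).1 then 1 else 0) :=
    countGE_add_of_eq_off (p := ⟨i, hij.trans hj⟩) (Fin.ne_of_lt hij) hoff y
  grind

theorem Reach.countGE_window_of_segment {i : Fin n} {j : ℕ} {hj : j ≤ i.1} {u v : SignedPerm n}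
    (h : Reach (segment i j hj) u v) (hm : m ≤ n) (him : i.1 < m) (y : ℕ) :
    countGE (window hm v) y = countGE (window hm u) y +
      (if (bar (value v i)).1 < y ∧ y ≤ (bar (value u i)).1 then 1 else 0) +
      if (value u i).1 < y ∧ y ≤ (value v i).1 then 1 else 0 := by
  induction j generalizing u with
  | zero =>
    obtain rfl := reach_nil_iff.1 h
    grind
  | succ j ih =>
    rcases reach_segment_succ_iff.1 h with h | ⟨w, s, h⟩
    · exact ih h
    · have hmono := h.value_le_of_segment i
      have hlt := s.value_lt
      have hl := s.left
      have hr := s.right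
      rw [ih h, s.countGE_window hm him]
      grind

end SegmentCount

section Existence

variable {n : ℕ} {u v w : SignedPerm n}

theorem exists_step {i q : Fin n} (h : q < i) (hlt : value u q < bar (value u i))
    (hside : IsUnbarred (value u q) ↔ IsUnbarred (bar (value u i)))
    (hbetween : ∀ m, q < m → m < i → value u m ∉ Ioo (value u q) (bar (value u i)))
    (hbeyond : ∀ m, i < m → value u m ∉ Ioo (value u q) (bar (value u i)) ∧
      value u m ∉ Ioo (value u i) (bar (value u q))) :
    ∃ w, Step u q i w :=
  ⟨_, (step_mul_refl_iff h).2
    ⟨hlt, hside, (sum_lengthChange_eq_zero_iff h hlt).2 ⟨hbetween, hbeyond⟩⟩⟩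

theorem exists_step_of_mem_Ico {i q : Fin n} (h : q < i) {z : Letter n}
    (hside : IsUnbarred (value u i) ↔ IsUnbarred z)
    (hskip : ∀ p, q < p → p < i → value u p ∉ Ico (bar z) (bar (value u i)))
    (habs : ∀ y ∈ Icc (bar z) (bar (value u i)), MemAbs (window i.2 u) y)
    (hq : value u q ∈ Ico (bar z) (bar (value u i))) : ∃ w, Step u q i w := by
  refine exists_step h hq.2 (by grind) (fun m hqm hmi => ?_) fun m him => ?_
  · have := hskip m hqm hmi
    grind
  · have hnot (y : Letter n) (hy : value u m = y ∨ value u m = bar y) :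
        y ∉ Icc (bar z) (bar (value u i)) := fun hmem =>
      not_memAbs_window (q := m) him hy (habs y hmem)
    have hm := hnot (value u m) (.inl rfl)
    have hm' := hnot (bar (value u m)) (.inr (bar_bar _).symm)
    grind

/-- The path is found greedily, taking every step that does not move the value at `i` above `z`. -/
theorem exists_reach_segment {i : Fin n} {z : Letter n} {j : ℕ} (hji : j ≤ i.1)
    (hle : value u i ≤ z) (hside : IsUnbarred (value u i) ↔ IsUnbarred z)
    (hskip : ∀ p, j ≤ p.1 → p < i → value u p ∉ Ico (bar z) (bar (value u i)))
    (habs : ∀ y ∈ Icc (bar z) (bar (value u i)), MemAbs (window i.2 u) y) :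
    ∃ w, Reach (segment i j hji) u w ∧ value w i ≤ z ∧
      ∀ p < i, value w p ∉ Ico (bar z) (bar (value w i)) := by
  induction j generalizing u with
  | zero => exact ⟨u, reach_nil_iff.2 rfl, hle, fun p => hskip p p.1.zero_le⟩
  | succ j ih =>
    obtain ⟨q, rfl⟩ : ∃ q : Fin n, q.1 = j := ⟨⟨j, by omega⟩, rfl⟩
    have hskip' (p : Fin n) (hqp : q < p) (hpi : p < i) := hskip p hqp hpi
    by_cases hq : value u q ∈ Ico (bar z) (bar (value u i))
    · obtain ⟨w, s⟩ := exists_step_of_mem_Ico hji hside hskip' habs hq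
      have hl := s.left
      have hr := s.right
      have ha := s.ascent (m := i.1 + 1) i.2 i.1.lt_succ_self
      obtain ⟨v, hv, hvz⟩ := ih (u := w) (by omega) (by grind)
        ((s.isUnbarred_iff i).symm.trans hside)
        (fun p hqp hpi => by
          rcases hqp.eq_or_lt with hpq | hqp
          · obtain rfl := Fin.ext hpq
            grind
          · have hp := hskip' p hqp hpi
            rw [s.of_ne p (Fin.ne_of_gt hqp) hpi.ne]
            grind)
        fun y hy => (ha.memAbs_iff y).1 (habs y (by grind))
      exact ⟨v, reach_segment_succ_iff.2 (.inr ⟨w, s, hv⟩), hvz⟩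
    · obtain ⟨v, hv, hvz⟩ := ih (by omega) hle hside
        (fun p hqp hpi => by
          rcases hqp.eq_or_lt with hpq | hqp
          · exact Fin.ext hpq ▸ hq
          · exact hskip' p hqp hpi) habs
      exact ⟨v, reach_segment_succ_iff.2 (.inl hv), hvz⟩

variable {k : ℕ} {hk : k + 1 ≤ n} {C' : Fin (k + 1) → Letter n}

theorem Ascent.memAbs_of_mem_Icc (ha : Ascent (window hk u) C') {y : Letter n}
    (hy : y ∈ Icc (bar (C' (Fin.last k))) (bar (value u ⟨k, hk⟩))) : MemAbs (window hk u) y := by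
  by_contra hn
  have hcross := ha.not_cross (bar y) (mt memAbs_bar.1 hn) (Fin.last k)
  have hne : value u ⟨k, hk⟩ ≠ bar y := fun h => hn ⟨Fin.last k, .inr h⟩
  have hcross' : bar y ∉ Ioc (value u ⟨k, hk⟩) (C' (Fin.last k)) := hcross
  grind

theorem exists_reach_segment_to (hC' : IsColumn C') (ha : Ascent (window hk u) C')
    (havoid : Avoids (window hk u) C') :
    ∃ w, Reach (segment ⟨k, hk⟩ k le_rfl) u w ∧ value w ⟨k, hk⟩ = C' (Fin.last k) := by
  have hside : IsUnbarred (value u ⟨k, hk⟩) ↔ IsUnbarred (C' (Fin.last k)) := ha.side (Fin.last k)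
  have hle : value u ⟨k, hk⟩ ≤ C' (Fin.last k) := ha.le (Fin.last k)
  obtain ⟨w, h, hwz, hskip⟩ := exists_reach_segment (u := u) (i := ⟨k, hk⟩) le_rfl hle hside
    (fun p hkp hpk => absurd hpk hkp.not_gt) fun y => ha.memAbs_of_mem_Icc
  refine ⟨w, h, by_contra fun hne => ?_⟩
  have haw := h.segment_ascent hk k.lt_succ_self
  have hlew := h.value_le_of_segment ⟨k, hk⟩
  obtain ⟨q, hqk, hq⟩ := memAbs_window_iff.1 <| (haw.memAbs_iff _).1 <|
    ha.memAbs_of_mem_Icc (y := bar (C' (Fin.last k))) ⟨le_rfl, by grind⟩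
  have hsidew : IsUnbarred (value u q) ↔ IsUnbarred (value w q) := haw.side ⟨q, hqk⟩
  have hsidek : IsUnbarred (value u ⟨k, hk⟩) ↔ IsUnbarred (value w ⟨k, hk⟩) := haw.side (Fin.last k)
  rcases (Nat.le_of_lt_succ hqk).eq_or_lt with hqk' | hqk'
  · obtain rfl : q = ⟨k, hk⟩ := Fin.ext hqk'
    grind
  · have hskipq := hskip q hqk'
    rcases (h.value_le_of_segment q).eq_or_lt with heq | hlt
    · have hav : C' (Fin.last k) ∉ Ico (value u q) (C' ⟨q, hqk⟩) :=
        havoid ⟨q, hqk⟩ (Fin.last k) hqk'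
      have haq : value u q ≤ C' ⟨q, hqk⟩ := ha.le ⟨q, hqk⟩
      have hne : C' ⟨q, hqk⟩ ≠ C' (Fin.last k) := fun h =>
        absurd (congrArg Fin.val (hC'.eq_of_eq_or_eq_bar (.inl h))) hqk'.ne
      grind
    · obtain ⟨hlow, hhigh, -⟩ := h.changed_of_segment (p := q) hqk' hlt
      grind

end Existence

section AfterSegment

variable {n : ℕ} {u v w : SignedPerm n}

theorem Ascent.bar_last_not_mem_Ioc {k : ℕ} {C C' : Fin (k + 1) → Letter n} (ha : Ascent C C')
    (hC : IsColumn C) (hC' : IsColumn C') (havoid : Avoids C C') (p : Fin (k + 1)) :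
    bar (C' (Fin.last k)) ∉ Ioc (C p) (C' p) := by
  intro hp
  have hle : countGE C' ((C' (Fin.last k)).1 + 1) ≤ countGE C ((C' (Fin.last k)).1 + 1) :=
    countGE_le fun q hq => by
      rcases (Fin.le_last q).eq_or_lt with rfl | hlast
      · exact absurd hq (Nat.not_succ_le_self _)
      · have := havoid q (Fin.last k) hlast
        grind
  have hlt : countGE C (2 * n - ((C' (Fin.last k)).1 + 1)) <
      countGE C' (2 * n - ((C' (Fin.last k)).1 + 1)) :=
    countGE_lt (q := p) (fun q hq => hq.trans (Fin.le_def.1 (ha.le q))) (by grind) (by grind)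
  have hsymm := countGE_add_countGE_sub hC hC' ha.memAbs_iff ((C' (Fin.last k)).1 + 1)
  omega

variable {k : ℕ} {hk : k + 1 ≤ n} {C' : Fin (k + 1) → Letter n}

theorem countGE_window_le_of_segment (hC' : IsColumn C') (ha : Ascent (window hk u) C')
    (h : Reach (segment ⟨k, hk⟩ k le_rfl) u w) (hwk : value w ⟨k, hk⟩ = C' (Fin.last k)) (y : ℕ) :
    countGE (window hk w) y ≤ countGE C' y := by
  have hle (y : ℕ) : countGE (window hk u) y ≤ countGE C' y :=
    countGE_le fun q hq => hq.trans (Fin.le_def.1 (ha.le q))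
  have hlt (y : ℕ) (hy : (value u ⟨k, hk⟩).1 < y) (hy' : y ≤ (C' (Fin.last k)).1) :
      countGE (window hk u) y < countGE C' y :=
    countGE_lt (q := Fin.last k) (fun q hq => hq.trans (Fin.le_def.1 (ha.le q))) hy hy'
  have hcount := h.countGE_window_of_segment hk k.lt_succ_self y
  have hsymm := countGE_add_countGE_sub (isColumn_window hk u) hC' ha.memAbs_iff y
  have hy := hle y
  have hlt_y := hlt y
  have hlt_sub := hlt (2 * n - y)
  have hside : IsUnbarred (value u ⟨k, hk⟩) ↔ IsUnbarred (C' (Fin.last k)) := ha.side (Fin.last k)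
  rw [hwk] at hcount
  grind

theorem value_le_of_reach_segment (hC' : IsColumn C') (ha : Ascent (window hk u) C')
    (havoid : Avoids (window hk u) C') (h : Reach (segment ⟨k, hk⟩ k le_rfl) u w)
    (hwk : value w ⟨k, hk⟩ = C' (Fin.last k)) (p : Fin (k + 1)) : window hk w p ≤ C' p := by
  by_contra hnot
  have hlt : C' p < value w (Fin.castLE hk p) := not_le.1 hnot
  have hpk : p.1 < k := Fin.val_lt_last (by rintro rfl; exact hlt.ne' hwk)
  obtain ⟨hlow, hhigh, hlater⟩ := h.changed_of_segment (p := Fin.castLE hk p) hpk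
    ((ha.le p).trans_lt hlt)
  refine (countGE_window_le_of_segment hC' ha h hwk ((C' p).1 + 1)).not_gt ?_
  refine countGE_lt (q := p) (fun q hq => ?_) (Nat.lt_succ_self _) hlt
  have hle : value u (Fin.castLE hk q) ≤ value w (Fin.castLE hk q) := h.value_le_of_segment _
  change (C' p).1 + 1 ≤ (value w (Fin.castLE hk q)).1
  rcases lt_trichotomy q p with hqp | rfl | hpq
  · have hav : C' p ∉ Ico (value u (Fin.castLE hk q)) (C' q) := havoid q p hqp
    grind
  · exact absurd hq (Nat.not_succ_le_self _)
  · rcases (Fin.le_last q).eq_or_lt with rfl | hlast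
    · exact hq.trans hwk.ge
    · have hcross : bar (C' (Fin.last k)) ∉ Ioc (value u (Fin.castLE hk q)) (C' q) :=
        ha.bar_last_not_mem_Ioc (isColumn_window hk u) hC' havoid q
      have hleC : value u (Fin.castLE hk p) ≤ C' p := ha.le p
      have hq_later := hlater (Fin.castLE hk q) hpq hlast
      rw [hwk] at hlow hq_later
      grind

theorem ascent_init_of_reach_segment (hC' : IsColumn C') (ha : Ascent (window hk u) C')
    (havoid : Avoids (window hk u) C') (h : Reach (segment ⟨k, hk⟩ k le_rfl) u w)
    (hwk : value w ⟨k, hk⟩ = C' (Fin.last k)) :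
    Ascent (window (Nat.le_of_succ_le hk) w) (Fin.init C') := by
  have haw := h.segment_ascent hk k.lt_succ_self
  have hlast (y : Letter n) :
      MemAbs (window (Nat.le_of_succ_le hk) w) y ↔
        MemAbs C' y ∧ ¬(C' (Fin.last k) = y ∨ C' (Fin.last k) = bar y) := by
    rw [← hwk, ← ha.memAbs_iff, haw.memAbs_iff]
    exact (isColumn_window hk w).memAbs_init_iff
  refine ⟨fun p => value_le_of_reach_segment hC' ha havoid h hwk p.castSucc,
    fun p => (haw.side p.castSucc).symm.trans (ha.side p.castSucc),
    fun y => (hlast y).trans hC'.memAbs_init_iff.symm, fun y hy p hp => ?_⟩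
  have hle : value u (Fin.castLE hk p.castSucc) ≤ value w (Fin.castLE hk p.castSucc) :=
    haw.le p.castSucc
  have hp' : y ∈ Ioc (value w (Fin.castLE hk p.castSucc)) (C' p.castSucc) := hp
  by_cases hmem : MemAbs C' y
  · have hav : C' (Fin.last k) ∉ Ico (value u (Fin.castLE hk p.castSucc)) (C' p.castSucc) :=
      havoid p.castSucc (Fin.last k) p.castSucc_lt_last
    have hcross : bar (C' (Fin.last k)) ∉
        Ioc (value u (Fin.castLE hk p.castSucc)) (C' p.castSucc) :=
      ha.bar_last_not_mem_Ioc (isColumn_window hk u) hC' havoid p.castSucc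
    have hne := mt (hC'.eq_of_eq_or_eq_bar (p := p.castSucc) (q := Fin.last k))
      p.castSucc_lt_last.ne
    have hy_last := mt (hlast y).2 hy
    grind
  · have hcross : y ∉ Ioc (value u (Fin.castLE hk p.castSucc)) (C' p.castSucc) :=
      ha.not_cross y (mt (ha.memAbs_iff y).1 hmem) p.castSucc
    grind

theorem exists_reach_revGamma {k : ℕ} {hk : k ≤ n} {C' : Fin k → Letter n} (hC' : IsColumn C')
    (ha : Ascent (window hk u) C') (havoid : Avoids (window hk u) C') :
    ∃ v, Reach (revGamma n k hk) u v ∧ window hk v = C' := by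
  induction k generalizing u with
  | zero => exact ⟨u, reach_nil_iff.2 rfl, funext fun p => p.elim0⟩
  | succ k ih =>
    obtain ⟨w, h, hwk⟩ := exists_reach_segment_to hC' ha havoid
    have haw := h.segment_ascent hk k.lt_succ_self
    obtain ⟨v, h', hv⟩ := ih hC'.init (ascent_init_of_reach_segment hC' ha havoid h hwk)
      fun i l hil hmem =>
        havoid i.castSucc l.castSucc hil ⟨(haw.le i.castSucc).trans hmem.1, hmem.2⟩
    refine ⟨v, reach_append_iff.2 ⟨w, h, h'⟩, funext fun p => ?_⟩
    obtain ⟨p, rfl⟩ | rfl := p.eq_castSucc_or_eq_last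
    · exact congrFun hv p
    · exact (h'.value_eq_of_revGamma (p := ⟨k, hk⟩) le_rfl).trans hwk

theorem exists_reach_revGamma_iff {k : ℕ} {hk : k ≤ n} {C' : Fin k → Letter n}
    (hC' : IsColumn C') :
    (∃ v, Reach (revGamma n k hk) u v ∧ window hk v = C') ↔
      Ascent (window hk u) C' ∧ Avoids (window hk u) C' := by
  constructor
  · rintro ⟨v, h, rfl⟩
    exact ⟨h.revGamma_ascent hk le_rfl, h.avoids⟩
  · rintro ⟨ha, havoid⟩
    exact exists_reach_revGamma hC' ha havoid

end AfterSegment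

section Monotonicity

variable {n k : ℕ} {hk : k ≤ n} {u : SignedPerm n} {C' : Fin k → Letter n}
  {P : List (PosRoot n × SignedPerm n)}

theorem pairwise_ascent (hP : IsRightPath hk u C' P) :
    (vertices u P).Pairwise fun w w' => Ascent (window hk w) (window hk w') :=
  (isChain_ascent hP).pairwise

theorem ascent_of_mem_vertices (hP : IsRightPath hk u C' P) {w : SignedPerm n}
    (hw : w ∈ vertices u P) : Ascent (window hk u) (window hk w) := by
  rcases List.mem_cons.1 hw with rfl | hw
  · exact .refl _
  · exact List.rel_of_pairwise_cons (pairwise_ascent hP) (List.mem_map.2 (List.mem_map.1 hw))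

theorem pairwise_window_le (hP : IsRightPath hk u C' P) (i : Fin k) :
    ((vertices u P).map fun w => window hk w i).Pairwise (· ≤ ·) :=
  List.pairwise_map.2 ((pairwise_ascent hP).imp fun h => h.le i)

theorem forall_isUnbarred_or_forall_not (hP : IsRightPath hk u C' P) (i : Fin k) :
    (∀ w ∈ vertices u P, IsUnbarred (window hk w i)) ∨
      ∀ w ∈ vertices u P, ¬IsUnbarred (window hk w i) := by
  by_cases hu : IsUnbarred (window hk u i)
  · exact .inl fun w hw => ((ascent_of_mem_vertices hP hw).side i).1 hu
  · exact .inr fun w hw => mt ((ascent_of_mem_vertices hP hw).side i).2 hu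

end Monotonicity

section Compatibility

variable {n k : ℕ} {C C' : Fin k → Letter n}

theorem ord_eq_ord_iff : ord C = ord C' ↔ ∃ σ : Equiv.Perm (Fin k), C = C' ∘ σ := by
  constructor
  · intro h
    refine ⟨(Tuple.sort C).symm.trans (Tuple.sort C'), funext fun p => ?_⟩
    simpa [ord] using congrFun h ((Tuple.sort C).symm p)
  · rintro ⟨σ, rfl⟩
    have hmono : Monotone (C' ∘ (σ * Tuple.sort (C' ∘ σ) : Equiv.Perm (Fin k))) :=
      Tuple.monotone_sort (C' ∘ σ)
    exact Tuple.unique_monotone hmono (Tuple.monotone_sort C')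

theorem ord_eq_ord_of_forall_mem_range (hC : Function.Injective C) (h : ∀ p, C p ∈ range C') :
    ord C = ord C' := by
  choose σ hσ using h
  have hinj : Function.Injective σ := fun p q hpq => hC (by rw [← hσ p, ← hσ q, hpq])
  exact ord_eq_ord_iff.2
    ⟨.ofBijective σ (Finite.injective_iff_bijective.1 hinj), funext fun p => (hσ p).symm⟩

theorem memAbs_iff_mem_range {y : Letter n} : MemAbs C y ↔ y ∈ range C ∨ bar y ∈ range C :=
  exists_or

theorem memAbs_comp_perm {σ : Equiv.Perm (Fin k)} {y : Letter n} :
    MemAbs (C ∘ σ) y ↔ MemAbs C y :=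
  σ.exists_congr_left.trans (by simp [MemAbs])

theorem countGE_comp_perm (σ : Equiv.Perm (Fin k)) (y : ℕ) : countGE (C ∘ σ) y = countGE C y := by
  rw [countGE_eq_sum, countGE_eq_sum]
  exact Equiv.sum_comp σ fun p => if y ≤ (C p).1 then 1 else 0

/-- The part of the relation `Ascent C C'` that does not depend on the order of the entries of the
two columns, expressed by the numbers of entries above each threshold. It describes the pairs
`(lD, rD)`. -/
structure Compatible (C C' : Fin k → Letter n) : Prop where
  memAbs_iff : ∀ y, MemAbs C y ↔ MemAbs C' y
  countGE_le : ∀ y, countGE C y ≤ countGE C' y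
  countGE_eq : ∀ y, ¬MemAbs C y → countGE C y.1 = countGE C' y.1
  countGE_middle : countGE C n = countGE C' n

theorem Compatible.comp_perm (h : Compatible C C') (σ τ : Equiv.Perm (Fin k)) :
    Compatible (C ∘ σ) (C' ∘ τ) := by
  constructor <;> simp only [memAbs_comp_perm, countGE_comp_perm]
  exacts [h.memAbs_iff, h.countGE_le, h.countGE_eq, h.countGE_middle]

theorem Ascent.compatible (h : Ascent C C') : Compatible C C' := by
  have hle (y : ℕ) : countGE C y ≤ countGE C' y :=
    TypeC.countGE_le fun p hp => hp.trans (Fin.le_def.1 (h.le p))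
  refine ⟨h.memAbs_iff, hle, fun y hy => (hle y).antisymm (TypeC.countGE_le fun p hp => ?_),
    (hle n).antisymm (TypeC.countGE_le fun p hp => ?_)⟩
  · have := h.not_cross y hy p
    grind
  · have := h.side p
    grind

theorem Compatible.ascent (h : Compatible C C') (hle : ∀ p, C p ≤ C' p) : Ascent C C' := by
  have hcross {y : ℕ} (hy : countGE C y = countGE C' y) (p : Fin k) :
      ¬((C p).1 < y ∧ y ≤ (C' p).1) := fun hp =>
    (countGE_lt (fun q hq => hq.trans (Fin.le_def.1 (hle q))) hp.1 hp.2).ne hy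
  refine ⟨hle, fun p => ?_, h.memAbs_iff, fun y hy p => hcross (h.countGE_eq y hy) p⟩
  have := hcross h.countGE_middle p
  have := hle p
  grind

theorem le_of_conditionOne (hcond : ConditionOne C' C) (h : ∀ y, countGE C y ≤ countGE C' y)
    (p : Fin k) : C p ≤ C' p := by
  cases k with
  | zero => exact p.elim0
  | succ k =>
    by_contra! hlt
    have hlast (q : Fin (k + 1)) (hq : q ≠ Fin.last k) := hcond q _ (Fin.lt_last_iff_ne_last.2 hq)
    simp only [Fin.sbtw_iff] at hlast
    refine (h ((C' (Fin.last k)).1 + 1)).not_gt (countGE_lt (q := p) (fun q hq => ?_) ?_ ?_)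
    all_goals grind

theorem conditionOne_iff_avoids (hC' : Function.Injective C') (hle : ∀ p, C p ≤ C' p) :
    ConditionOne C' C ↔ Avoids C C' := by
  refine forall₃_congr fun i l hil => ?_
  have hne := hC'.ne hil.ne
  have := hle i
  rw [Fin.sbtw_iff]
  grind

end Compatibility

section Enumeration

variable {α : Type*} [LinearOrder α] {r : ℕ}

/-- The decreasing enumeration of a finite set. -/
def revEnum (s : Finset α) (hs : s.card = r) (i : Fin r) : α := s.orderEmbOfFin hs i.rev

variable {s : Finset α} {hs : s.card = r}

theorem revEnum_strictAnti : StrictAnti (revEnum s hs) :=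
  (s.orderEmbOfFin hs).strictMono.comp_strictAnti Fin.rev_strictAnti

theorem range_revEnum : range (revEnum s hs) = s := by
  rw [← s.range_orderEmbOfFin hs]
  exact Fin.rev_surjective.range_comp _

theorem le_revEnum_iff {x : α} {i : Fin r} :
    x ≤ revEnum s hs i ↔ i.1 < (s.filter (x ≤ ·)).card := by
  have hcard : (s.filter (x ≤ ·)).card = (Finset.univ.filter (x ≤ revEnum s hs ·)).card := by
    rw [← Finset.card_image_of_injective _ (revEnum_strictAnti (hs := hs)).injective]
    congr 1
    ext y
    have hy : y ∈ s ↔ y ∈ range (revEnum s hs) := by rw [range_revEnum, Finset.mem_coe]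
    simp only [Finset.mem_filter, Finset.mem_image, Finset.mem_univ, true_and, hy, mem_range]
    grind
  rw [hcard]
  constructor
  · intro hx
    rw [← Nat.succ_le_iff, Nat.succ_eq_add_one, ← Fin.card_Iic]
    exact Finset.card_le_card fun j hj => by
      simpa using hx.trans (revEnum_strictAnti.antitone (Finset.mem_Iic.1 hj))
  · contrapose!
    intro hx
    rw [← Fin.card_Iio]
    refine Finset.card_le_card fun j hj => Finset.mem_Iio.2 ?_
    exact revEnum_strictAnti.lt_iff_gt.1 (hx.trans_le (Finset.mem_filter.1 hj).2)

end Enumeration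

section Splitting

variable {n k : ℕ} {D : Fin k → Letter n} {t : Fin (pairSet D).card → Letter n}

theorem mem_pairSet {x : Letter n} :
    x ∈ pairSet D ↔ IsUnbarred x ∧ x ∈ range D ∧ bar x ∈ range D := by
  simp only [pairSet, Finset.mem_filter, Finset.mem_univ, true_and]

theorem pairSeq_eq_revEnum (D : Fin k → Letter n) : pairSeq D = revEnum (pairSet D) rfl := rfl

theorem pairSeq_strictAnti : StrictAnti (pairSeq D) := revEnum_strictAnti

theorem mem_range_pairSeq {x : Letter n} :
    x ∈ range (pairSeq D) ↔ IsUnbarred x ∧ x ∈ range D ∧ bar x ∈ range D := by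
  rw [pairSeq_eq_revEnum, range_revEnum, Finset.mem_coe, mem_pairSet]

theorem pairSeq_mem (i : Fin (pairSet D).card) :
    IsUnbarred (pairSeq D i) ∧ pairSeq D i ∈ range D ∧ bar (pairSeq D i) ∈ range D :=
  mem_range_pairSeq.1 (mem_range_self i)

/-- The column `lD` before it is sorted. -/
noncomputable def leftFilling (D : Fin k → Letter n) (t : Fin (pairSet D).card → Letter n) :
    Fin k → Letter n :=
  Function.extend (pairSeq D) t id ∘ D

/-- The column `rD` before it is sorted. -/
noncomputable def rightFilling (D : Fin k → Letter n) (t : Fin (pairSet D).card → Letter n) :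
    Fin k → Letter n :=
  Function.extend (bar ∘ pairSeq D) (bar ∘ t) id ∘ D

theorem leftFilling_of_eq {p : Fin k} {i : Fin (pairSet D).card} (h : D p = pairSeq D i) :
    leftFilling D t p = t i := by
  rw [leftFilling, Function.comp_apply, h, pairSeq_strictAnti.injective.extend_apply]

theorem rightFilling_of_eq {p : Fin k} {i : Fin (pairSet D).card} (h : D p = bar (pairSeq D i)) :
    rightFilling D t p = bar (t i) := by
  rw [rightFilling, Function.comp_apply, h]
  exact (bar_injective.comp pairSeq_strictAnti.injective).extend_apply _ _ i

theorem leftFilling_of_forall_ne {p : Fin k} (h : ∀ i, D p ≠ pairSeq D i) :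
    leftFilling D t p = D p :=
  Function.extend_apply' _ _ _ fun ⟨i, hi⟩ => h i hi.symm

theorem rightFilling_of_forall_ne {p : Fin k} (h : ∀ i, D p ≠ bar (pairSeq D i)) :
    rightFilling D t p = D p :=
  Function.extend_apply' _ _ _ fun ⟨i, hi⟩ => h i hi.symm

theorem filling_cases (D : Fin k → Letter n) (t : Fin (pairSet D).card → Letter n) (p : Fin k) :
    (∃ i, D p = pairSeq D i ∧ leftFilling D t p = t i ∧ rightFilling D t p = pairSeq D i) ∨
    (∃ i, D p = bar (pairSeq D i) ∧ leftFilling D t p = bar (pairSeq D i) ∧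
      rightFilling D t p = bar (t i)) ∨
    bar (D p) ∉ range D ∧ leftFilling D t p = D p ∧ rightFilling D t p = D p := by
  have hne (i j) : pairSeq D i ≠ bar (pairSeq D j) := fun h => by
    have := (pairSeq_mem i).1
    have := (pairSeq_mem j).1
    grind
  by_cases hbar : bar (D p) ∈ range D
  · by_cases hu : IsUnbarred (D p)
    · obtain ⟨i, hi⟩ := mem_range_pairSeq.2 ⟨hu, mem_range_self p, hbar⟩
      refine .inl ⟨i, hi.symm, leftFilling_of_eq hi.symm, ?_⟩
      rw [rightFilling_of_forall_ne fun j => hi ▸ hne i j, hi]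
    · obtain ⟨i, hi⟩ := mem_range_pairSeq.2
        ⟨isUnbarred_bar.2 hu, hbar, (bar_bar (D p)).symm ▸ mem_range_self p⟩
      have hp : D p = bar (pairSeq D i) := by rw [hi, bar_bar]
      refine .inr (.inl ⟨i, hp, ?_, rightFilling_of_eq hp⟩)
      rw [leftFilling_of_forall_ne fun j => hp ▸ (hne j i).symm, hp]
  · refine .inr (.inr ⟨hbar, leftFilling_of_forall_ne fun i hi => hbar ?_,
      rightFilling_of_forall_ne fun i hi => hbar ?_⟩)
    · exact hi ▸ (pairSeq_mem i).2.2
    · rw [hi, bar_bar]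
      exact (pairSeq_mem i).2.1

end Splitting

section Forward

variable {n k : ℕ} {D C C' : Fin k → Letter n} {t : Fin (pairSet D).card → Letter n}

theorem IsSplitting.mem_of_between (ht : IsSplitting D t) (i : Fin (pairSet D).card)
    {x : Letter n} (hx : x ∈ Icc (t i) (pairSeq D i)) : MemAbs D x ∨ x ∈ range t := by
  by_contra! hn
  obtain ⟨hD, hnt⟩ := hn
  have hmem := pairSeq_mem i
  have hD' := mt memAbs_iff_mem_range.2 hD
  have hne : x ≠ pairSeq D i := fun h => hD' (.inl (h ▸ hmem.2.1))
  have hne' : t i ≠ x := fun h => hnt ⟨i, h⟩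
  obtain ⟨m, hm⟩ := i
  induction m with
  | zero =>
    refine hne' (le_antisymm hx.1 ((ht ⟨0, hm⟩).2 ⟨?_, ?_, fun j hj => ?_, ?_⟩))
    all_goals grind
  | succ m ih =>
    have hanti := pairSeq_strictAnti (D := D) (a := ⟨m, Nat.lt_of_succ_lt hm⟩) (b := ⟨m + 1, hm⟩)
      (Nat.lt_succ_self m)
    refine hne' (le_antisymm hx.1 ((ht ⟨m + 1, hm⟩).2 ⟨?_, ?_, fun j hj => ?_, ?_⟩))
    · grind
    · grind
    · obtain rfl : j = ⟨m, Nat.lt_of_succ_lt hm⟩ := Fin.ext (Nat.succ.inj hj)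
      by_contra! hle
      exact ih _ ⟨hle, hx.2.trans hanti.le⟩ (pairSeq_mem _) (hx.2.trans_lt hanti).ne
        fun h => hnt ⟨_, h⟩
    · grind

theorem memAbs_leftFilling_iff {y : Letter n} :
    MemAbs (leftFilling D t) y ↔ MemAbs D y ∨ y ∈ range t ∨ bar y ∈ range t := by
  have hcase := filling_cases D t
  have hz := pairSeq_mem (D := D)
  constructor
  · rintro ⟨p, hp⟩
    have := hcase p
    grind [MemAbs]
  · rintro (⟨p, hp⟩ | h)
    · rcases hcase p with ⟨i, h⟩ | ⟨i, h⟩ | h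
      · obtain ⟨q, hq⟩ := (hz i).2.2
        have hqz := hcase q
        refine ⟨q, ?_⟩
        grind
      · exact ⟨p, by grind⟩
      · exact ⟨p, by grind⟩
    · obtain ⟨i, hi⟩ : ∃ i, t i = y ∨ t i = bar y := by grind
      obtain ⟨p, hp⟩ := (hz i).2.1
      exact ⟨p, by rwa [leftFilling_of_eq hp]⟩

theorem memAbs_rightFilling_iff {y : Letter n} :
    MemAbs (rightFilling D t) y ↔ MemAbs D y ∨ y ∈ range t ∨ bar y ∈ range t := by
  have hcase := filling_cases D t
  have hz := pairSeq_mem (D := D)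
  constructor
  · rintro ⟨p, hp⟩
    have := hcase p
    grind [MemAbs]
  · rintro (⟨p, hp⟩ | h)
    · rcases hcase p with ⟨i, h⟩ | ⟨i, h⟩ | h
      · exact ⟨p, by grind⟩
      · obtain ⟨q, hq⟩ := (hz i).2.1
        have hqz := hcase q
        refine ⟨q, ?_⟩
        grind
      · exact ⟨p, by grind⟩
    · obtain ⟨i, hi⟩ : ∃ i, t i = y ∨ t i = bar y := by grind
      obtain ⟨p, hp⟩ := (hz i).2.2
      exact ⟨p, by grind [rightFilling_of_eq hp (t := t)]⟩

theorem IsSplitting.ascent (ht : IsSplitting D t) :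
    Ascent (leftFilling D t) (rightFilling D t) := by
  have hlt (i) : IsUnbarred (t i) ∧ t i < pairSeq D i := ⟨(ht i).1.1, (ht i).1.2.1⟩
  refine ⟨fun p => ?_, fun p => ?_, fun y => ?_, fun y hy p hp => ?_⟩
  · rcases filling_cases D t p with ⟨i, h⟩ | ⟨i, h⟩ | h <;> grind
  · rcases filling_cases D t p with ⟨i, h⟩ | ⟨i, h⟩ | h
    · have := pairSeq_mem i
      grind
    · have := pairSeq_mem i
      grind
    · grind
  · rw [memAbs_leftFilling_iff, memAbs_rightFilling_iff]
  · rw [memAbs_leftFilling_iff] at hy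
    rcases filling_cases D t p with ⟨i, h⟩ | ⟨i, h⟩ | h
    · have := ht.mem_of_between i (x := y)
      grind
    · have := ht.mem_of_between i (x := bar y)
      have := memAbs_bar (C := D) (y := y)
      grind
    · grind

theorem KNColumn.compatible (D : KNColumn n k) (hC' : ord C' = D.right) (hC : ord C = D.left) :
    Compatible C C' := by
  obtain ⟨σ, rfl⟩ := ord_eq_ord_iff.1 hC
  obtain ⟨τ, rfl⟩ := ord_eq_ord_iff.1 hC'
  exact D.isSplitting.ascent.compatible.comp_perm σ τ

end Forward

section Converse

variable {n k : ℕ} {C C' D : Fin k → Letter n}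

theorem IsColumn.bar_not_mem_range (hC : IsColumn C) {y : Letter n} (hy : y ∈ range C) :
    bar y ∉ range C := by
  rintro ⟨q, hq⟩
  obtain ⟨p, rfl⟩ := hy
  obtain rfl := hC.eq_of_eq_or_eq_bar (.inr hq)
  exact bar_ne_self _ hq.symm

open Classical in
/-- The unbarred entries of `C` whose bars are entries of `C'`. For `C = lD` and `C' = rD` this is
the set of the `t_i`, and with `C` and `C'` exchanged it is the set of the `z_i`. -/
noncomputable def flipSet (C C' : Fin k → Letter n) : Finset (Letter n) :=
  Finset.univ.filter fun s => IsUnbarred s ∧ s ∈ range C ∧ bar s ∈ range C'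

theorem mem_flipSet {s : Letter n} :
    s ∈ flipSet C C' ↔ IsUnbarred s ∧ s ∈ range C ∧ bar s ∈ range C' := by
  simp only [flipSet, Finset.mem_filter, Finset.mem_univ, true_and]

open Classical in
/-- The unbarred entries of `C` that are at least `y`, as a set of letters; `y` is a natural number
as in `countGE`. -/
noncomputable def unbarredGE (C : Fin k → Letter n) (y : ℕ) : Finset (Letter n) :=
  Finset.univ.filter fun s => IsUnbarred s ∧ y ≤ s.1 ∧ s ∈ range C

theorem mem_unbarredGE {y : ℕ} {s : Letter n} :
    s ∈ unbarredGE C y ↔ IsUnbarred s ∧ y ≤ s.1 ∧ s ∈ range C := by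
  simp only [unbarredGE, Finset.mem_filter, Finset.mem_univ, true_and]

theorem countGE_eq_card_unbarredGE_add (hC : Function.Injective C) {y : ℕ} (hy : y ≤ n) :
    countGE C y = (unbarredGE C y).card + countGE C n := by
  classical
  have himage : unbarredGE C y =
      (Finset.univ.filter fun p => y ≤ (C p).1 ∧ (C p).1 < n).image C := by
    ext s
    simp only [mem_unbarredGE, Finset.mem_image, Finset.mem_filter, Finset.mem_univ, true_and]
    grind
  rw [himage, Finset.card_image_of_injective _ hC, countGE, countGE,
    ← Finset.card_union_of_disjoint]
  · congr 1
    grind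
  · grind [Finset.disjoint_left]

theorem Compatible.card_filter_flipSet (h : Compatible C C') (hC : IsColumn C) (hC' : IsColumn C')
    {y : ℕ} (hy : y ≤ n) :
    ((flipSet C' C).filter (y ≤ ·.1)).card + countGE C y =
      ((flipSet C C').filter (y ≤ ·.1)).card + countGE C' y := by
  have hsdiff {A B : Fin k → Letter n} (hB : IsColumn B) (hAB : ∀ s, MemAbs A s ↔ MemAbs B s) :
      (flipSet A B).filter (y ≤ ·.1) = unbarredGE A y \ unbarredGE B y := by
    ext s
    have hbar := hB.bar_not_mem_range (y := s)
    have hs := hAB s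
    simp only [memAbs_iff_mem_range] at hs
    simp only [Finset.mem_filter, mem_flipSet, Finset.mem_sdiff, mem_unbarredGE]
    tauto
  rw [countGE_eq_card_unbarredGE_add hC.injective hy,
    countGE_eq_card_unbarredGE_add hC'.injective hy, h.countGE_middle,
    hsdiff hC fun s => (h.memAbs_iff s).symm, hsdiff hC' h.memAbs_iff]
  have hcard := Finset.card_sdiff_add_card (unbarredGE C' y) (unbarredGE C y)
  have hcard' := Finset.card_sdiff_add_card (unbarredGE C y) (unbarredGE C' y)
  rw [Finset.union_comm] at hcard'
  omega

theorem Compatible.card_flipSet (h : Compatible C C') (hC : IsColumn C) (hC' : IsColumn C') :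
    (flipSet C C').card = (flipSet C' C).card := by
  have hcard := h.card_filter_flipSet hC hC' n.zero_le
  simp only [countGE, Nat.zero_le, Finset.filter_true] at hcard
  omega

/-- `D` lists in increasing order the unbarred entries of `C'` and the barred entries of `C`; this
is how `D` is recovered from `C = lD` and `C' = rD`. -/
structure IsMerge (C C' D : Fin k → Letter n) : Prop where
  strictMono : StrictMono D
  mem_range_iff : ∀ s, s ∈ range D ↔ if IsUnbarred s then s ∈ range C' else s ∈ range C

theorem exists_isMerge (hC : Function.Injective C) (hC' : Function.Injective C')
    (h : countGE C n = countGE C' n) : ∃ D, IsMerge C C' D := by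
  classical
  set A := (Finset.univ.filter fun p => ¬n ≤ (C' p).1).image C'
  set B := (Finset.univ.filter fun p => n ≤ (C p).1).image C
  have hcard : (A ∪ B).card = k := by
    rw [Finset.card_union_of_disjoint (by grind [Finset.disjoint_left]),
      Finset.card_image_of_injective _ hC', Finset.card_image_of_injective _ hC, ← countGE, h,
      countGE, add_comm, Finset.card_filter_add_card_filter_not, Finset.card_univ,
      Fintype.card_fin]
  refine ⟨(A ∪ B).orderEmbOfFin hcard, OrderEmbedding.strictMono _, fun s => ?_⟩
  rw [Finset.range_orderEmbOfFin]
  grind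

namespace IsMerge

variable (hD : IsMerge C C' D)
include hD

theorem mem_range_iff_right {s : Letter n} (hs : IsUnbarred s) : s ∈ range D ↔ s ∈ range C' := by
  rw [hD.mem_range_iff, if_pos hs]

theorem bar_mem_range_iff_left {s : Letter n} (hs : IsUnbarred s) :
    bar s ∈ range D ↔ bar s ∈ range C := by
  rw [hD.mem_range_iff, if_neg fun h => isUnbarred_bar.1 h hs]

theorem pairSet_eq : pairSet D = flipSet C' C := by
  ext s
  rw [mem_pairSet, mem_flipSet]
  have := hD.mem_range_iff_right (s := s)
  have := hD.bar_mem_range_iff_left (s := s)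
  tauto

variable {t : Fin (pairSet D).card → Letter n}

theorem left_mem_range_leftFilling (hC : IsColumn C) (habs : ∀ y, MemAbs C y ↔ MemAbs C' y)
    (ht : range t = flipSet C C') (p : Fin k) : C p ∈ range (leftFilling D t) := by
  have hcase := filling_cases D t
  have hpair := pairSeq_mem (D := D)
  by_cases hflip : C p ∈ flipSet C C'
  · obtain ⟨i, hi⟩ : C p ∈ range t := by rwa [ht]
    obtain ⟨q, hq⟩ := (hpair i).2.1
    exact ⟨q, by rw [leftFilling_of_eq hq, hi]⟩
  · have hmem : C p ∈ range D := by
      have hp := (habs (C p)).1 ⟨p, .inl rfl⟩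
      rw [memAbs_iff_mem_range] at hp
      rw [mem_flipSet] at hflip
      rw [hD.mem_range_iff]
      grind
    obtain ⟨q, hq⟩ := hmem
    have hbar := hC.bar_not_mem_range (mem_range_self p)
    have hDbar := hD.bar_mem_range_iff_left (s := C p)
    refine ⟨q, ?_⟩
    rcases hcase q with ⟨i, h⟩ | ⟨i, h⟩ | h
    · have := hpair i
      grind
    · grind
    · grind

theorem right_mem_range_rightFilling (hC' : IsColumn C') (habs : ∀ y, MemAbs C y ↔ MemAbs C' y)
    (ht : range t = flipSet C C') (p : Fin k) : C' p ∈ range (rightFilling D t) := by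
  have hcase := filling_cases D t
  have hpair := pairSeq_mem (D := D)
  by_cases hflip : bar (C' p) ∈ flipSet C C'
  · obtain ⟨i, hi⟩ : bar (C' p) ∈ range t := by rwa [ht]
    obtain ⟨q, hq⟩ := (hpair i).2.2
    exact ⟨q, by rw [rightFilling_of_eq hq, hi, bar_bar]⟩
  · have hmem : C' p ∈ range D := by
      have hp := (habs (C' p)).2 ⟨p, .inl rfl⟩
      rw [memAbs_iff_mem_range] at hp
      rw [mem_flipSet, isUnbarred_bar, bar_bar] at hflip
      rw [hD.mem_range_iff]
      grind
    obtain ⟨q, hq⟩ := hmem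
    have hbar := hC'.bar_not_mem_range (mem_range_self p)
    have hDbar := hD.mem_range_iff_right (s := bar (C' p))
    refine ⟨q, ?_⟩
    rcases hcase q with ⟨i, h⟩ | ⟨i, h⟩ | h
    · grind
    · have := hpair i
      grind
    · grind

theorem le_pairSeq_iff {x : Letter n} {i : Fin (pairSet D).card} :
    x ≤ pairSeq D i ↔ i.1 < ((flipSet C' C).filter (x ≤ ·)).card := by
  rw [pairSeq_eq_revEnum, le_revEnum_iff, ← hD.pairSet_eq]

theorem isSplitting (h : Compatible C C') (hC : IsColumn C) (hC' : IsColumn C')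
    (hcard : (flipSet C C').card = (pairSet D).card) :
    IsSplitting D (revEnum (flipSet C C') hcard) := by
  intro i
  obtain ⟨hu, hmemC, hmemC'⟩ :=
    mem_flipSet.1 (range_revEnum.subset (mem_range_self (f := revEnum _ hcard) i))
  have hcount {x : Letter n} (hx : IsUnbarred x) :
      ((flipSet C' C).filter (x ≤ ·)).card + countGE C x.1 =
        ((flipSet C C').filter (x ≤ ·)).card + countGE C' x.1 :=
    h.card_filter_flipSet hC hC' hx.le
  have hnot : revEnum _ hcard i ∉ range D := fun hmem =>
    hC'.bar_not_mem_range ((hD.mem_range_iff_right hu).1 hmem) hmemC'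
  have hbar : bar (revEnum _ hcard i) ∉ range D := fun hmem =>
    hC.bar_not_mem_range hmemC ((hD.bar_mem_range_iff_left hu).1 hmem)
  refine ⟨⟨hu, lt_of_le_of_ne (hD.le_pairSeq_iff.2 ?_) fun heq => hnot ?_,
    fun j hj => revEnum_strictAnti (Fin.lt_def.2 (by omega)), hnot, hbar⟩, ?_⟩
  · have := le_revEnum_iff.1 (le_refl (revEnum _ hcard i))
    have := hcount hu
    have := h.countGE_le (revEnum _ hcard i).1
    omega
  · exact heq ▸ (pairSeq_mem i).2.1
  · rintro x ⟨hx, hxz, hprev, hxD, hbarD⟩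
    by_contra! hlt
    by_cases habs : MemAbs C x
    · have hmem : x ∈ flipSet C C' := mem_flipSet.2 ⟨hx,
        (memAbs_iff_mem_range.1 habs).resolve_right (mt (hD.bar_mem_range_iff_left hx).2 hbarD),
        (memAbs_iff_mem_range.1 ((h.memAbs_iff x).1 habs)).resolve_left
          (mt (hD.mem_range_iff_right hx).2 hxD)⟩
      obtain ⟨j, rfl⟩ := (range_revEnum (hs := hcard)).superset hmem
      have hji : j < i := revEnum_strictAnti.lt_iff_gt.1 hlt
      have := revEnum_strictAnti.lt_iff_gt.1 (hprev ⟨i.1 - 1, by omega⟩ (by grind))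
      grind
    · have := hcount hx
      have := h.countGE_eq x habs
      have := hD.le_pairSeq_iff.1 hxz.le
      have := mt le_revEnum_iff.2 hlt.not_ge
      omega

end IsMerge

theorem Compatible.exists_knColumn (h : Compatible C C') (hC : IsColumn C) (hC' : IsColumn C') :
    ∃ D : KNColumn n k, ord C' = D.right ∧ ord C = D.left := by
  obtain ⟨D, hD⟩ := exists_isMerge hC.injective hC'.injective h.countGE_middle
  have hcard : (flipSet C C').card = (pairSet D).card := by
    rw [hD.pairSet_eq, h.card_flipSet hC hC']
  exact ⟨⟨D, hD.strictMono, revEnum _ hcard, hD.isSplitting h hC hC' hcard⟩,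
    ord_eq_ord_of_forall_mem_range hC'.injective
      (hD.right_mem_range_rightFilling hC' h.memAbs_iff range_revEnum),
    ord_eq_ord_of_forall_mem_range hC.injective
      (hD.left_mem_range_leftFilling hC h.memAbs_iff range_revEnum)⟩

theorem conditionOne_and_exists_knColumn_iff (hC : IsColumn C) (hC' : IsColumn C') :
    (ConditionOne C' C ∧ ∃ D : KNColumn n k, ord C' = D.right ∧ ord C = D.left) ↔
      Ascent C C' ∧ Avoids C C' := by
  constructor
  · rintro ⟨hcond, D, hright, hleft⟩
    have h := D.compatible hright hleft
    have hle := le_of_conditionOne hcond h.countGE_le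
    exact ⟨h.ascent hle, (conditionOne_iff_avoids hC'.injective hle).1 hcond⟩
  · rintro ⟨h, havoid⟩
    exact ⟨(conditionOne_iff_avoids hC'.injective h.le).2 havoid,
      h.compatible.exists_knColumn hC hC'⟩

end Converse

end TypeC

theorem mainTheorem9 {n k : ℕ} (hk : k ≤ n) (u : TypeC.SignedPerm n)
    (C' : Fin k → TypeC.Letter n) (hC' : TypeC.IsColumn C') :
    ((TypeC.ConditionOne C' (TypeC.window hk u) ∧
        ∃ D : TypeC.KNColumn n k,
          TypeC.ord C' = D.right ∧ TypeC.ord (TypeC.window hk u) = D.left) ↔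
      ∃ P, TypeC.IsRightPath hk u C' P) ∧
    (∀ P Q, TypeC.IsRightPath hk u C' P → TypeC.IsRightPath hk u C' Q → P = Q) ∧
    (∀ P, TypeC.IsRightPath hk u C' P → ∀ i : Fin k,
      ((TypeC.vertices u P).map fun w => TypeC.window hk w i).Pairwise (· ≤ ·) ∧
      ((∀ w ∈ TypeC.vertices u P, TypeC.IsUnbarred (TypeC.window hk w i)) ∨
        (∀ w ∈ TypeC.vertices u P, ¬ TypeC.IsUnbarred (TypeC.window hk w i)))) := by
  open TypeC in
  refine ⟨?_, ?_, fun P hP i => ?_⟩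
  · rw [conditionOne_and_exists_knColumn_iff (isColumn_window hk u) hC', exists_isRightPath_iff,
      exists_reach_revGamma_iff hC']
  · rintro P Q ⟨hP, hPend, hPsub⟩ ⟨hQ, hQend, hQsub⟩
    rw [reverse_GammaR] at hPsub hQsub
    exact separates_revGamma k hk u P Q hP hQ hPsub hQsub (hPend.trans hQend.symm)
  · exact ⟨pairwise_window_le hP i, forall_isUnbarred_or_forall_not hP i⟩
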